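/- Let $\mathcal F$ be an ordinary differential field of characteristic $0$ with derivation $\delta$, and let $u$ be an element, differentially transcendental over $\mathcal F$, of a differential extension field of $\mathcal F$. Let $A\in\mathcal F\{x,y\}$ be an irreducible differential polynomial, and let $\mathrm{sat}(A)=[A]:(S_AI_A)^\infty$, where $[A]$ is the differential ideal generated by $A$, and $S_A$ and $I_A$ are the separant and the initial of $A$ under some ranking of the derivatives of $x,y$. Let $P_1,Q_1,P_2,Q_2\in\mathcal F\{u\}$ with $Q_i\neq 0$ and $\gcd(P_i,Q_i)=1$ for $i=1,2$, and put $\mathcal P(u)=\big(\tfrac{P_1(u)}{Q_1(u)},\tfrac{P_2(u)}{Q_2(u)}\big)$. Suppose that $\mathcal P(u)$ is a differential rational parametrization of the (unirational) differential curve $(\mathcal C,A)$, i.e. a generic point of it: for every $f\in\mathcal F\{x,y\}$, $f(\mathcal P(u))=0$ if and only if $f\in\mathrm{sat}(A)$. Suppose moreover that $\mathcal P(u)$ is linear: $\mathcal P(u)\notin\mathcal F^2$ and $P_1,Q_1,P_2,Q_2$ all have degree at most $1$ as polynomials in $u,u',u'',\dots$. For $z\in\{x,y,u\}$ let $\mathrm{ord}_z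 f$ be the largest $k$ such that $z^{(k)}$ occurs in $f$, with $\mathrm{ord}_z f=-\infty$ if no derivative $z^{(k)}$, $k\ge 0$, occurs in $f$, and let $\mathrm{ord}(P_i/Q_i)=\max\{\mathrm{ord}_uP_i,\mathrm{ord}_uQ_i\}$. Theorem. $\mathcal P(u)$ is proper, that is, the differential fields $\mathcal F\big\langle \tfrac{P_1(u)}{Q_1(u)},\tfrac{P_2(u)}{Q_2(u)}\big\rangle$ and $\mathcal F\langle u\rangle$ generated over $\mathcal F$ coincide, if and only if $$\mathrm{ord}\Big(\frac{P_1(u)}{Q_1(u)}\Big)=\mathrm{ord}_yA\quad\text{and}\quad \mathrm{ord}\Big(\frac{P_2(u)}{Q_2(u)}\Big)=\mathrm{ord}_xA .$$ -/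

import Mathlib

/-! Ordinary differential polynomials, saturation ideals, and rational parametrizations of
plane differential curves. A differential field is a field with a `Differential` structure;
`Differential.deriv` is its derivation `δ`. -/

/-- The differential polynomial ring over `F` in the differential indeterminates `y_i`, `i : σ`:
the variable `(i, k)` stands for the `k`-th derivative of `y_i`. -/
abbrev DiffPoly (σ F : Type*) [CommRing F] := MvPolynomial (σ × ℕ) F

namespace DiffPoly

variable {σ F : Type*} [CommRing F] [Differential F]

/-- Apply the derivation of `F` to every coefficient. -/
noncomputable def coeffDeriv (f : DiffPoly σ F) : DiffPoly σ F :=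
  f.support.sum fun m => MvPolynomial.monomial m (Differential.deriv (f.coeff m))

theorem coeff_coeffDeriv (f : DiffPoly σ F) (m : σ × ℕ →₀ ℕ) :
    (coeffDeriv f).coeff m = Differential.deriv (f.coeff m) := by
  classical
  simp only [coeffDeriv, MvPolynomial.coeff_sum, MvPolynomial.coeff_monomial,
    Finset.sum_ite_eq', MvPolynomial.mem_support_iff]
  split_ifs with h
  · rfl
  · rw [not_not.mp h, map_zero]

/-- The coefficientwise derivation, as a derivation of the polynomial ring. -/
noncomputable def coeffDerivation : Derivation ℤ (DiffPoly σ F) (DiffPoly σ F) :=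
  Derivation.mk'
    (AddMonoidHom.toIntLinearMap
      { toFun := coeffDeriv
        map_zero' := by ext m; simp [coeff_coeffDeriv]
        map_add' := fun f g => by ext m; simp [coeff_coeffDeriv] })
    (fun f g => by
      classical
      change coeffDeriv (f * g) = f • coeffDeriv g + g • coeffDeriv f
      ext m
      rw [smul_eq_mul, smul_eq_mul, mul_comm g, MvPolynomial.coeff_add, coeff_coeffDeriv,
        MvPolynomial.coeff_mul, MvPolynomial.coeff_mul, MvPolynomial.coeff_mul, map_sum,
        ← Finset.sum_add_distrib]
      refine Finset.sum_congr rfl fun p _ => ?_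
      rw [Derivation.leibniz, coeff_coeffDeriv, coeff_coeffDeriv, smul_eq_mul, smul_eq_mul,
        mul_comm (g.coeff p.2)])

/-- The derivation of `F{y_i : i ∈ σ}`: it extends that of `F` and sends `y_i^(k)` to
`y_i^(k+1)` (see `deriv_C` and `deriv_X`). -/
noncomputable instance instDifferential : Differential (DiffPoly σ F) where
  deriv := coeffDerivation + (MvPolynomial.mkDerivation F
    (fun v : σ × ℕ => (MvPolynomial.X (v.1, v.2 + 1) : DiffPoly σ F))).restrictScalars ℤ

theorem deriv_C (a : F) :
    Differential.deriv (MvPolynomial.C a : DiffPoly σ F) =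
      MvPolynomial.C (Differential.deriv a) := by
  classical
  change coeffDeriv (MvPolynomial.C a) + MvPolynomial.mkDerivation F _ (MvPolynomial.C a) = _
  rw [MvPolynomial.derivation_C, add_zero]
  ext m
  rw [coeff_coeffDeriv, MvPolynomial.coeff_C, MvPolynomial.coeff_C]
  split_ifs <;> simp

theorem deriv_X (v : σ × ℕ) :
    Differential.deriv (MvPolynomial.X v : DiffPoly σ F) = MvPolynomial.X (v.1, v.2 + 1) := by
  classical
  change coeffDeriv (MvPolynomial.X v) + MvPolynomial.mkDerivation F _ (MvPolynomial.X v) = _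
  rw [MvPolynomial.mkDerivation_X]
  have : coeffDeriv (MvPolynomial.X v : DiffPoly σ F) = 0 := by
    ext m
    rw [coeff_coeffDeriv, MvPolynomial.coeff_X, MvPolynomial.coeff_zero]
    split_ifs <;> simp
  rw [this, zero_add]

/-- The differential ideal `[f]` generated by `f`: the ideal generated by the derivatives
`f, f', f'', …`. -/
noncomputable def diffIdeal (f : DiffPoly σ F) : Ideal (DiffPoly σ F) :=
  Ideal.span (Set.range fun k : ℕ => (⇑Differential.deriv)^[k] f)

/-- `[f]` is closed under the derivation. -/
theorem deriv_mem_diffIdeal (f : DiffPoly σ F) {g : DiffPoly σ F} (hg : g ∈ diffIdeal f) :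
    Differential.deriv g ∈ diffIdeal f := by
  refine Submodule.span_induction ?_ ?_ ?_ ?_ hg
  · rintro _ ⟨k, rfl⟩
    refine Ideal.subset_span ⟨k + 1, ?_⟩
    exact Function.iterate_succ_apply' _ _ _
  · rw [map_zero]
    exact Ideal.zero_mem _
  · intro a b _ _ ha hb
    rw [map_add]
    exact Ideal.add_mem _ ha hb
  · intro a b hb hb'
    rw [smul_eq_mul, Derivation.leibniz, smul_eq_mul, smul_eq_mul]
    exact Ideal.add_mem _ (Ideal.mul_mem_left _ _ hb') (Ideal.mul_mem_right _ _ hb)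

/-- `ord i f` is the largest `k` such that `y_i^(k)` occurs in `f`, and `⊥` (that is, `-∞`) if
neither `y_i` nor any of its derivatives occurs in `f`. -/
noncomputable def ord {σ F : Type*} [CommRing F] (i : σ) (f : DiffPoly σ F) : WithBot ℕ :=
  open Classical in (f.vars.filter fun v => v.1 = i).sup fun v => (v.2 : WithBot ℕ)

/-- A ranking: a total order on the derivatives `y_i^(k)`, compatible with the derivation. -/
structure IsRanking {σ : Type*} (r : σ × ℕ → σ × ℕ → Prop) : Prop where
  isStrictTotalOrder : IsStrictTotalOrder (σ × ℕ) r
  lt_deriv : ∀ v, r v (v.1, v.2 + 1)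
  deriv_lt_deriv : ∀ v w, r v w → r (v.1, v.2 + 1) (w.1, w.2 + 1)

/-- `v` is the leader of `f`: the highest derivative occurring in `f`. -/
def IsLeader {σ F : Type*} [CommRing F] (r : σ × ℕ → σ × ℕ → Prop) (f : DiffPoly σ F)
    (v : σ × ℕ) : Prop :=
  v ∈ f.vars ∧ ∀ w ∈ f.vars, w ≠ v → r w v

/-- The leading coefficient of `f`, written as a univariate polynomial in the variable `v`;
for the leader `v` of `f` this is the initial of `f`. -/
noncomputable def initial {σ F : Type*} [CommRing F] (f : DiffPoly σ F) (v : σ × ℕ) :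
    DiffPoly σ F :=
  (f.support.filter fun m => m v = f.degreeOf v).sum fun m =>
    MvPolynomial.monomial (m.erase v) (f.coeff m)

/-- The partial derivative of `f` with respect to `v`; for the leader `v` of `f` this is the
separant of `f`. -/
noncomputable def separant {σ F : Type*} [CommRing F] (f : DiffPoly σ F) (v : σ × ℕ) :
    DiffPoly σ F :=
  MvPolynomial.pderiv v f

/-- The saturation ideal `sat(f) = [f] : (S_f I_f)^∞`, where `v` is the leader of `f`. -/
noncomputable def sat (f : DiffPoly σ F) (v : σ × ℕ) : Ideal (DiffPoly σ F) where
  carrier := {g | ∃ m : ℕ, (separant f v * initial f v) ^ m * g ∈ diffIdeal f}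
  zero_mem' := ⟨0, by rw [mul_zero]; exact Ideal.zero_mem _⟩
  add_mem' := by
    rintro a b ⟨m, hm⟩ ⟨n, hn⟩
    refine ⟨m + n, ?_⟩
    rw [mul_add]
    refine Ideal.add_mem _ ?_ ?_
    · rw [pow_add, mul_comm (_ ^ m), mul_assoc]
      exact Ideal.mul_mem_left _ _ hm
    · rw [pow_add, mul_assoc]
      exact Ideal.mul_mem_left _ _ hn
  smul_mem' := by
    rintro c a ⟨m, hm⟩
    refine ⟨m, ?_⟩
    rw [smul_eq_mul, mul_left_comm]
    exact Ideal.mul_mem_left _ _ hm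

section Extension

variable {E : Type*} [Field E] [Differential E]

/-- Evaluation of differential polynomials at a point `η`: `y_i^(k)` is sent to `δ^k (η i)`. -/
noncomputable def evalAt {σ F : Type*} [Field F] [Algebra F E] (η : σ → E) :
    DiffPoly σ F →ₐ[F] E :=
  MvPolynomial.aeval fun v => (⇑Differential.deriv)^[v.2] (η v.1)

/-- `𝕀(η)`: the ideal of all differential polynomials over `F` that vanish at `η`. -/
noncomputable def vanishingIdeal {σ : Type*} (F : Type*) [Field F] [Algebra F E] (η : σ → E) :
    Ideal (DiffPoly σ F) :=
  RingHom.ker (evalAt (F := F) η)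

end Extension

end DiffPoly

/-- `u` is differentially transcendental over `F`. -/
def IsDiffTranscendental (F : Type*) {E : Type*} [Field F] [Field E] [Differential E]
    [Algebra F E] (u : E) : Prop :=
  AlgebraicIndependent F fun k : ℕ => (⇑Differential.deriv)^[k] u

/-- The differential field `F⟨S⟩` generated over `F` by a subset `S` of `E`. -/
def diffAdjoin (F : Type*) {E : Type*} [Field F] [Field E] [Differential E]
    [Algebra F E] (S : Set E) : IntermediateField F E :=
  IntermediateField.adjoin F {b | ∃ a ∈ S, ∃ k : ℕ, b = (⇑Differential.deriv)^[k] a}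

/-- The point `(P₁(u)/Q₁(u), P₂(u)/Q₂(u))`. -/
noncomputable def ratPoint {F E : Type*} [Field F] [Field E] [Differential E] [Algebra F E]
    (P Q : Fin 2 → DiffPoly Unit F) (u : E) : Fin 2 → E :=
  fun i => DiffPoly.evalAt (fun _ => u) (P i) / DiffPoly.evalAt (fun _ => u) (Q i)

/-- The order of a differential rational function `p / q` in reduced form. -/
noncomputable def ratOrd {F : Type*} [Field F] (p q : DiffPoly Unit F) : WithBot ℕ :=
  max (DiffPoly.ord () p) (DiffPoly.ord () q)

/-- For an irreducible `A ∈ F{x, y}` with leader `v` (the indeterminate `x` has index `0` and `y`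
has index `1`) and `u` differentially transcendental over `F`: `(P₁(u)/Q₁(u), P₂(u)/Q₂(u))` is
a differential rational parametrization, in reduced form, of the curve defined by `A`, that is,
a generic point of `sat(A)`. -/
structure IsRatParametrization {F E : Type*} [Field F] [Differential F] [Field E]
    [Differential E] [Algebra F E] (A : DiffPoly (Fin 2) F) (v : Fin 2 × ℕ)
    (P Q : Fin 2 → DiffPoly Unit F) (u : E) : Prop where
  denom_ne_zero : ∀ i, Q i ≠ 0
  reduced : ∀ i, IsRelPrime (P i) (Q i)
  generic : DiffPoly.vanishingIdeal F (ratPoint P Q u) = DiffPoly.sat A v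

/-- The pair `(P₁(u)/Q₁(u), P₂(u)/Q₂(u))`, in reduced form, is linear: it does not lie in `F²`,
and all numerators and denominators have degree at most one. -/
structure IsLinearRat {F E : Type*} [Field F] [Field E] [Differential E] [Algebra F E]
    (P Q : Fin 2 → DiffPoly Unit F) (u : E) : Prop where
  not_const : ¬ ∀ i, ratPoint P Q u i ∈ Set.range (algebraMap F E)
  degree_num : ∀ i, (P i).totalDegree ≤ 1
  degree_denom : ∀ i, (Q i).totalDegree ≤ 1

/-- The parametrization is proper: `F⟨P₁(u)/Q₁(u), P₂(u)/Q₂(u)⟩ = F⟨u⟩`. -/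
def IsProperParam {F E : Type*} [Field F] [Field E] [Differential E] [Algebra F E]
    (P Q : Fin 2 → DiffPoly Unit F) (u : E) : Prop :=
  diffAdjoin F (Set.range (ratPoint P Q u)) = diffAdjoin F {u}

/-!
The Kähler differentials `Ω[E⁄F]` form a module over the linear differential operators with
coefficients in `E`: the derivation of `E` acts on them by the Lie derivative. As `u` is
differentially transcendental, the iterates of `du` are linearly independent. For `η = 𝒫(u)` of
degree at most one, `dηᵢ` is a linear differential operator of order `ord (Pᵢ/Qᵢ)` applied to `du`,
while `A`, linearized at `η`, gives a single relation between the derivatives of `dη₀` and `dη₁`,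
of orders `ord_x A` and `ord_y A`. Comparing the dimensions of the spaces spanned by the first few
derivatives, `du` is a combination of the derivatives of `dη₀` and `dη₁` if and only if the orders
match.

It remains to deduce `u ∈ L = F⟨η₀, η₁⟩` from this relation, which a priori has coefficients in `E`.
By linearity `Qᵢ(u) dηᵢ` is the value at `du` of a linear form with coefficients in `L`, whose value
at `u` is again in `L`. An `E`-linear relation between `L`-rational forms yields an `L`-linear one,
and the latter can be evaluated at `u`.
-/

open scoped KaehlerDifferential

section DifferentialModule

open Module Submodule

/-- A connection on a module `V` over a differential ring `K`: an additive map satisfying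
the Leibniz rule. -/
structure IsConnection (K : Type*) {V : Type*} [CommRing K] [Differential K] [AddCommGroup V]
    [Module K V] (nabla : V →+ V) : Prop where
  leibniz : ∀ (a : K) (x : V), nabla (a • x) = Differential.deriv a • x + a • nabla x

/-- The span of `x, ∇x, …, ∇ⁿ⁻¹x`. -/
def orbitSpan (K : Type*) {V : Type*} [Field K] [AddCommGroup V] [Module K V]
    (nabla : V →+ V) (x : V) (n : ℕ) : Submodule K V :=
  span K ((fun k => nabla^[k] x) '' Set.Iio n)

/-- `y` has order `m` with respect to `u`: it is a combination of `u, ∇u, …, ∇ᵐu` in which `∇ᵐu`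
has a nonzero coefficient. -/
def HasOrder (K : Type*) {V : Type*} [Field K] [AddCommGroup V] [Module K V]
    (nabla : V →+ V) (u y : V) (m : ℕ) : Prop :=
  ∃ c : K, c ≠ 0 ∧ y - c • nabla^[m] u ∈ orbitSpan K nabla u m

/-- The orbits of `x` and `y` are tied by a single relation of order `a` in `x` and `b` in `y`.
This is encoded by the dimensions of the spans of their initial segments, whose growth the
relation determines. -/
def HasRelationOrders (K : Type*) {V : Type*} [Field K] [AddCommGroup V] [Module K V]
    (nabla : V →+ V) (x y : V) (a b : ℕ) : Prop :=
  ∀ k l, finrank K ↥(orbitSpan K nabla x (a + k) ⊔ orbitSpan K nabla y (b + l)) =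
    a + b + max k l

variable {K V : Type*} [Field K] [AddCommGroup V] [Module K V] {nabla : V →+ V} {x y u : V}

theorem iterate_mem_orbitSpan_of_lt {i n : ℕ} (h : i < n) : nabla^[i] x ∈ orbitSpan K nabla x n :=
  subset_span ⟨i, h, rfl⟩

theorem orbitSpan_le {n : ℕ} {W : Submodule K V} (h : ∀ i < n, nabla^[i] x ∈ W) :
    orbitSpan K nabla x n ≤ W :=
  span_le.mpr (Set.image_subset_iff.mpr h)

theorem orbitSpan_mono {i n : ℕ} (h : i ≤ n) : orbitSpan K nabla x i ≤ orbitSpan K nabla x n :=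
  span_mono (Set.image_mono (Set.Iio_subset_Iio h))

theorem orbitSpan_zero : orbitSpan K nabla x 0 = ⊥ := by
  simp [orbitSpan]

theorem orbitSpan_succ (n : ℕ) :
    orbitSpan K nabla x (n + 1) = orbitSpan K nabla x n ⊔ span K {nabla^[n] x} := by
  have hIio : Set.Iio (n + 1) = Set.Iio n ∪ {n} := by
    ext i
    simp
  rw [orbitSpan, orbitSpan, ← span_union, hIio, Set.image_union, Set.image_singleton]

theorem orbitSpan_eq_span_range (n : ℕ) :
    orbitSpan K nabla x n = span K (Set.range fun i : Fin n => nabla^[i] x) := by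
  rw [orbitSpan, ← Fin.range_val, ← Set.range_comp]
  rfl

theorem orbitSpan_of_zero (n : ℕ) : orbitSpan K nabla 0 n = ⊥ :=
  eq_bot_iff.mpr (orbitSpan_le fun i _ => by simp [iterate_map_zero])

instance finiteDimensional_orbitSpan (n : ℕ) : FiniteDimensional K (orbitSpan K nabla x n) :=
  FiniteDimensional.span_of_finite K ((Set.finite_Iio n).image _)

theorem finrank_orbitSpan_le (n : ℕ) : finrank K (orbitSpan K nabla x n) ≤ n := by
  rw [orbitSpan_eq_span_range]
  exact (finrank_range_le_card _).trans (Fintype.card_fin n).le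

theorem finrank_orbitSpan (h : LinearIndependent K fun k => nabla^[k] x) (n : ℕ) :
    finrank K (orbitSpan K nabla x n) = n := by
  rw [orbitSpan_eq_span_range]
  exact (finrank_span_eq_card (h.comp _ Fin.val_injective)).trans (Fintype.card_fin n)

theorem finrank_orbitSpan_sup {a b : ℕ}
    (h : LinearIndependent K
      (Sum.elim (fun i : Fin a => nabla^[i] x) (fun i : Fin b => nabla^[i] y))) :
    finrank K ↥(orbitSpan K nabla x a ⊔ orbitSpan K nabla y b) = a + b := by
  rw [orbitSpan_eq_span_range, orbitSpan_eq_span_range, ← span_union, ← Set.Sum.elim_range]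
  exact (finrank_span_eq_card h).trans (by simp)

theorem HasOrder.sup_span {m : ℕ} (h : HasOrder K nabla u y m) :
    orbitSpan K nabla u m ⊔ span K {y} = orbitSpan K nabla u (m + 1) := by
  obtain ⟨c, hc, hy⟩ := h
  rw [orbitSpan_succ]
  refine le_antisymm (sup_le le_sup_left ?_) (sup_le le_sup_left ?_) <;>
    rw [span_singleton_le_iff_mem]
  · rw [← sub_add_cancel y (c • nabla^[m] u)]
    exact add_mem (mem_sup_left hy) (smul_mem _ _ (mem_sup_right (mem_span_singleton_self _)))
  · rw [← inv_smul_smul₀ hc (nabla^[m] u), ← sub_sub_cancel y (c • nabla^[m] u)]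
    exact smul_mem _ _ (sub_mem (mem_sup_right (mem_span_singleton_self _)) (mem_sup_left hy))

theorem HasRelationOrders.symm {a b : ℕ} (h : HasRelationOrders K nabla x y a b) :
    HasRelationOrders K nabla y x b a := fun k l => by
  rw [sup_comm, h, add_comm a, max_comm]

namespace IsConnection

variable [Differential K]

theorem map_mem_of_mem_span (h : IsConnection K nabla) {S : Set V} {W : Submodule K V}
    (hS : S ⊆ W) (hnabla : ∀ z ∈ S, nabla z ∈ W) {z : V} (hz : z ∈ span K S) : nabla z ∈ W := by
  induction hz using span_induction with
  | mem z hz => exact hnabla z hz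
  | zero => simp
  | add z w _ _ hz hw => simpa only [map_add] using add_mem hz hw
  | smul a z hz hnz =>
    rw [h.leibniz]
    exact add_mem (smul_mem _ _ (span_le.mpr hS hz)) (smul_mem _ _ hnz)

theorem map_mem_orbitSpan (h : IsConnection K nabla) {n : ℕ} {z : V}
    (hz : z ∈ orbitSpan K nabla x n) : nabla z ∈ orbitSpan K nabla x (n + 1) := by
  refine h.map_mem_of_mem_span ?_ ?_ hz
  · exact span_le.mp (orbitSpan_mono n.le_succ)
  · rintro _ ⟨i, hi, rfl⟩
    rw [← Function.iterate_succ_apply' (⇑nabla)]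
    exact iterate_mem_orbitSpan_of_lt (Nat.succ_lt_succ hi)

theorem iterate_mem_orbitSpan (h : IsConnection K nabla) {n : ℕ} {z : V}
    (hz : z ∈ orbitSpan K nabla x n) (k : ℕ) : nabla^[k] z ∈ orbitSpan K nabla x (n + k) := by
  induction k with
  | zero => exact hz
  | succ k ih =>
    rw [Function.iterate_succ_apply']
    exact h.map_mem_orbitSpan ih

theorem iterate_mem_orbitSpan_sup (h : IsConnection K nabla) {s t : ℕ} {z : V}
    (hz : z ∈ orbitSpan K nabla x s ⊔ orbitSpan K nabla y t) (k : ℕ) :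
    nabla^[k] z ∈ orbitSpan K nabla x (s + k) ⊔ orbitSpan K nabla y (t + k) := by
  obtain ⟨p, hp, q, hq, rfl⟩ := mem_sup.mp hz
  rw [iterate_map_add]
  exact add_mem_sup (h.iterate_mem_orbitSpan hp k) (h.iterate_mem_orbitSpan hq k)

theorem orbitSpan_le_sup (h : IsConnection K nabla) {s t : ℕ}
    (hu : u ∈ orbitSpan K nabla x s ⊔ orbitSpan K nabla y t) (m : ℕ) :
    orbitSpan K nabla u m ≤ orbitSpan K nabla x (s + m) ⊔ orbitSpan K nabla y (t + m) := by
  refine orbitSpan_le fun i hi => ?_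
  have hmono : orbitSpan K nabla x (s + i) ⊔ orbitSpan K nabla y (t + i) ≤
      orbitSpan K nabla x (s + m) ⊔ orbitSpan K nabla y (t + m) :=
    sup_le_sup (orbitSpan_mono (by lia)) (orbitSpan_mono (by lia))
  exact hmono (h.iterate_mem_orbitSpan_sup hu i)

theorem orbitSpan_le_sup_of_relation (h : IsConnection K nabla) {a b : ℕ}
    (hrel : nabla^[b] y ∈ orbitSpan K nabla x (a + 1) ⊔ orbitSpan K nabla y b) (l : ℕ) :
    orbitSpan K nabla y (b + l) ≤ orbitSpan K nabla x (a + l) ⊔ orbitSpan K nabla y b := by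
  induction l with
  | zero => exact le_sup_right
  | succ l ih =>
    have hprev : orbitSpan K nabla y (b + l) ≤
        orbitSpan K nabla x (a + 1 + l) ⊔ orbitSpan K nabla y b :=
      ih.trans (sup_le_sup_right (orbitSpan_mono (by lia)) _)
    rw [← add_assoc, orbitSpan_succ, ← add_assoc, add_right_comm a l 1]
    refine sup_le hprev ((span_singleton_le_iff_mem _ _).mpr ?_)
    rw [add_comm b l, Function.iterate_add_apply]
    exact sup_le le_sup_left hprev (h.iterate_mem_orbitSpan_sup hrel l)

theorem hasRelationOrders (h : IsConnection K nabla) {a b : ℕ}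
    (hy : nabla^[b] y ∈ orbitSpan K nabla x (a + 1) ⊔ orbitSpan K nabla y b)
    (hx : nabla^[a] x ∈ orbitSpan K nabla y (b + 1) ⊔ orbitSpan K nabla x a)
    (hrank : ∀ s, finrank K ↥(orbitSpan K nabla x s ⊔ orbitSpan K nabla y b) = s + b) :
    HasRelationOrders K nabla x y a b := by
  intro k l
  have hspan : orbitSpan K nabla x (a + k) ⊔ orbitSpan K nabla y (b + l) =
      orbitSpan K nabla x (a + max k l) ⊔ orbitSpan K nabla y b := by
    refine le_antisymm (sup_le ?_ ?_) (sup_le ?_ ?_)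
    · exact (orbitSpan_mono (by lia)).trans le_sup_left
    · exact (h.orbitSpan_le_sup_of_relation hy l).trans
        (sup_le_sup_right (orbitSpan_mono (by lia)) _)
    · rcases le_total l k with hlk | hkl
      · rw [max_eq_left hlk]
        exact le_sup_left
      · rw [max_eq_right hkl, sup_comm]
        exact (h.orbitSpan_le_sup_of_relation hx l).trans
          (sup_le_sup_left (orbitSpan_mono (by lia)) _)
    · exact (orbitSpan_mono (by lia)).trans le_sup_right
  rw [hspan, hrank]
  lia

end IsConnection

namespace HasOrder

variable [Differential K]

theorem iterate (h : IsConnection K nabla) {m : ℕ} (hy : HasOrder K nabla u y m) (k : ℕ) :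
    HasOrder K nabla u (nabla^[k] y) (m + k) := by
  induction k with
  | zero => exact hy
  | succ k ih =>
    obtain ⟨c, hc, hmem⟩ := ih
    refine ⟨c, hc, ?_⟩
    have hsplit : nabla^[k + 1] y - c • nabla^[m + (k + 1)] u =
        nabla (nabla^[k] y - c • nabla^[m + k] u) +
          Differential.deriv c • nabla^[m + k] u := by
      rw [map_sub, h.leibniz, ← add_assoc m, Function.iterate_succ_apply',
        Function.iterate_succ_apply']
      abel
    rw [hsplit]
    exact add_mem (h.map_mem_orbitSpan hmem)
      (smul_mem _ _ (iterate_mem_orbitSpan_of_lt (by lia)))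

theorem orbitSpan_sup_orbitSpan (h : IsConnection K nabla) {m : ℕ} (hy : HasOrder K nabla u y m)
    (k : ℕ) :
    orbitSpan K nabla u m ⊔ orbitSpan K nabla y k = orbitSpan K nabla u (m + k) := by
  induction k with
  | zero => rw [orbitSpan_zero, sup_bot_eq, add_zero]
  | succ k ih => rw [orbitSpan_succ, ← sup_assoc, ih, (hy.iterate h k).sup_span, add_assoc]

theorem orbitSpan_le (h : IsConnection K nabla) {m : ℕ} (hy : HasOrder K nabla u y m) (k : ℕ) :
    orbitSpan K nabla y k ≤ orbitSpan K nabla u (m + k) :=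
  le_sup_right.trans (hy.orbitSpan_sup_orbitSpan h k).le

theorem iterate_notMem_orbitSpan (h : IsConnection K nabla)
    (hu : LinearIndependent K fun k => nabla^[k] u) {m : ℕ} (hy : HasOrder K nabla u y m)
    (k : ℕ) : nabla^[k] y ∉ orbitSpan K nabla y k := by
  intro hk
  have hsucc := hy.orbitSpan_sup_orbitSpan h (k + 1)
  rw [orbitSpan_succ, sup_eq_left.mpr ((span_singleton_le_iff_mem _ _).mpr hk),
    hy.orbitSpan_sup_orbitSpan h] at hsucc
  have hrank := congrArg (fun W : Submodule K V => finrank K W) hsucc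
  simp only [finrank_orbitSpan hu] at hrank
  lia

theorem mem_orbitSpan_iff (h : IsConnection K nabla)
    (hu : LinearIndependent K fun k => nabla^[k] u) {n : ℕ} (hy : HasOrder K nabla u y n) :
    (∃ t, u ∈ orbitSpan K nabla y t) ↔ n = 0 := by
  constructor
  · rintro ⟨t, ht⟩
    have hle : orbitSpan K nabla u n ≤ orbitSpan K nabla y (t + n) := by
      simpa only [sup_idem] using h.orbitSpan_le_sup (x := y) (y := y) (t := t) (mem_sup_left ht) n
    have hrank := finrank_orbitSpan hu (n + (t + n))
    rw [← hy.orbitSpan_sup_orbitSpan h, sup_eq_right.mpr hle] at hrank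
    have := finrank_orbitSpan_le (K := K) (nabla := nabla) (x := y) (t + n)
    lia
  · rintro rfl
    have hspan := hy.orbitSpan_sup_orbitSpan h 1
    rw [orbitSpan_zero, bot_sup_eq] at hspan
    exact ⟨1, hspan ▸ iterate_mem_orbitSpan_of_lt (i := 0) (by lia)⟩

theorem le_of_hasRelationOrders (h : IsConnection K nabla)
    (hu : LinearIndependent K fun k => nabla^[k] u) {m n a b : ℕ}
    (hx : HasOrder K nabla u x m) (hy : HasOrder K nabla u y n)
    (hrel : HasRelationOrders K nabla x y a b) : b ≤ m := by
  have hle : orbitSpan K nabla x (a + (n + b)) ⊔ orbitSpan K nabla y (b + 0) ≤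
      orbitSpan K nabla u (m + (a + (n + b))) :=
    sup_le (hx.orbitSpan_le h _) ((hy.orbitSpan_le h _).trans (orbitSpan_mono (by lia)))
  have hrank := finrank_mono hle
  rw [hrel, finrank_orbitSpan hu] at hrank
  lia

theorem ge_of_mem_sup (h : IsConnection K nabla)
    (hu : LinearIndependent K fun k => nabla^[k] u) {m a b s t : ℕ}
    (hx : HasOrder K nabla u x m) (hrel : HasRelationOrders K nabla x y a b)
    (hmem : u ∈ orbitSpan K nabla x s ⊔ orbitSpan K nabla y t) : m ≤ b := by
  have hle : orbitSpan K nabla u (m + (a + (s + t + m))) ≤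
      orbitSpan K nabla x (a + (s + t + m)) ⊔ orbitSpan K nabla y (b + (s + t + m)) := by
    rw [← hx.orbitSpan_sup_orbitSpan h]
    exact sup_le ((h.orbitSpan_le_sup hmem m).trans
      (sup_le_sup (orbitSpan_mono (by lia)) (orbitSpan_mono (by lia)))) le_sup_left
  have hrank := finrank_mono hle
  rw [hrel, finrank_orbitSpan hu] at hrank
  lia

theorem mem_sup_iff (h : IsConnection K nabla)
    (hu : LinearIndependent K fun k => nabla^[k] u) {m n a b : ℕ}
    (hx : HasOrder K nabla u x m) (hy : HasOrder K nabla u y n)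
    (hrel : HasRelationOrders K nabla x y a b) :
    (∃ s t, u ∈ orbitSpan K nabla x s ⊔ orbitSpan K nabla y t) ↔ m = b ∧ n = a := by
  constructor
  · rintro ⟨s, t, hmem⟩
    exact ⟨(hx.ge_of_mem_sup h hu hrel hmem).antisymm (hx.le_of_hasRelationOrders h hu hy hrel),
      (hy.ge_of_mem_sup h hu hrel.symm (sup_comm (orbitSpan K nabla x s) _ ▸ hmem)).antisymm
        (hy.le_of_hasRelationOrders h hu hx hrel.symm)⟩
  · rintro ⟨rfl, rfl⟩
    have hle : orbitSpan K nabla x (n + 1) ⊔ orbitSpan K nabla y (m + 1) ≤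
        orbitSpan K nabla u (m + (n + 1)) :=
      sup_le (hx.orbitSpan_le h _) ((hy.orbitSpan_le h _).trans (orbitSpan_mono (by lia)))
    have heq := eq_of_le_of_finrank_eq hle (by rw [hrel, finrank_orbitSpan hu]; lia)
    exact ⟨n + 1, m + 1, heq ▸ iterate_mem_orbitSpan_of_lt (i := 0) (by lia)⟩

end HasOrder

end DifferentialModule

section LieDerivative

open KaehlerDifferential

variable (R S : Type*) [CommRing R] [CommRing S] [Algebra R S] [Differential S]

/-- The Lie derivative on formal combinations `∑ aᵢ dxᵢ`: it sends `a dx` to `a' dx + a dx'`. -/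
noncomputable def formalLieDerivative : (S →₀ S) →+ Ω[S⁄R] :=
  Finsupp.liftAddHom fun x =>
    ((LinearMap.toSpanSingleton S _ (D R S x)).toAddMonoidHom.comp
        (Differential.deriv : Derivation ℤ S S).toLinearMap.toAddMonoidHom) +
      (LinearMap.toSpanSingleton S _ (D R S (Differential.deriv x))).toAddMonoidHom

variable {R S}

theorem formalLieDerivative_single (x a : S) :
    formalLieDerivative R S (Finsupp.single x a) =
      Differential.deriv a • D R S x + a • D R S (Differential.deriv x) := by
  simp [formalLieDerivative]

theorem formalLieDerivative_smul (c : S) (f : S →₀ S) :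
    formalLieDerivative R S (c • f) =
      Differential.deriv c • Finsupp.linearCombination S (D R S) f +
        c • formalLieDerivative R S f := by
  induction f using Finsupp.induction_linear with
  | zero => simp
  | add f g hf hg => simp only [smul_add, map_add, hf, hg]; abel
  | single x a =>
    rw [Finsupp.smul_single, formalLieDerivative_single, formalLieDerivative_single,
      Finsupp.linearCombination_single, smul_eq_mul, Derivation.leibniz]
    module

variable [Differential R] [DifferentialAlgebra R S]

theorem formalLieDerivative_eq_zero {f : S →₀ S}
    (hf : Finsupp.linearCombination S (D R S) f = 0) : formalLieDerivative R S f = 0 := by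
  rw [← LinearMap.mem_ker, kerTotal_eq, kerTotal] at hf
  induction hf using Submodule.closure_induction with
  | zero => exact map_zero _
  | add f g _ _ hf hg => rw [map_add, hf, hg, add_zero]
  | smul_mem c f hf =>
    have hf_zero : Finsupp.linearCombination S (D R S) f = 0 := by
      rw [← LinearMap.mem_ker, kerTotal_eq]
      exact Submodule.subset_span hf
    rw [formalLieDerivative_smul, hf_zero, smul_zero, zero_add]
    convert smul_zero c
    obtain (⟨⟨x, y⟩, rfl⟩ | ⟨⟨x, y⟩, rfl⟩) | ⟨r, rfl⟩ := hf
    · simp [formalLieDerivative_single]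
    · simp only [map_sub, map_add, formalLieDerivative_single, Derivation.leibniz,
        Derivation.map_one_eq_zero, smul_eq_mul]
      module
    · simp [formalLieDerivative_single, deriv_algebraMap]

variable (R S)

/-- The Lie derivative on `Ω[S⁄R]` along the derivation of `S`. -/
noncomputable def lieDerivative : Ω[S⁄R] →+ Ω[S⁄R] :=
  (Finsupp.linearCombination S (D R S)).toAddMonoidHom.liftOfSurjective
    (linearCombination_surjective R S)
    ⟨formalLieDerivative R S, fun _ hf => formalLieDerivative_eq_zero hf⟩

variable {R S}

theorem lieDerivative_linearCombination (f : S →₀ S) :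
    lieDerivative R S (Finsupp.linearCombination S (D R S) f) = formalLieDerivative R S f :=
  AddMonoidHom.liftOfRightInverse_comp_apply _ _ _ _ f

theorem lieDerivative_D (x : S) : lieDerivative R S (D R S x) = D R S (Differential.deriv x) := by
  simpa [formalLieDerivative_single] using
    lieDerivative_linearCombination (R := R) (Finsupp.single x (1 : S))

theorem iterate_lieDerivative_D (x : S) (k : ℕ) :
    (lieDerivative R S)^[k] (D R S x) = D R S ((⇑Differential.deriv)^[k] x) :=
  (Function.Semiconj.iterate_right (fun x => (lieDerivative_D x).symm) k x).symm

variable (R S) in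
theorem isConnection_lieDerivative : IsConnection S (lieDerivative R S) where
  leibniz a x := by
    obtain ⟨f, rfl⟩ := linearCombination_surjective R S x
    rw [← map_smul, lieDerivative_linearCombination, lieDerivative_linearCombination,
      formalLieDerivative_smul]

end LieDerivative

section LinearForms

variable {K V : Type*} [CommRing K] [Differential K] [AddCommGroup V] [Module K V]

variable (K) in
/-- The derivation as an additive map; it is the standard connection on `K`. -/
def derivAddHom : K →+ K :=
  (Differential.deriv : Derivation ℤ K K).toLinearMap.toAddMonoidHom

variable (K) in
theorem isConnection_deriv : IsConnection K (derivAddHom K) where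
  leibniz a x := by
    change Differential.deriv (a * x) = Differential.deriv a * x + a * Differential.deriv x
    rw [Derivation.leibniz, smul_eq_mul, smul_eq_mul, add_comm, mul_comm x]

variable (K) in
/-- The derivation of linear differential forms `∑ cⱼ z⁽ʲ⁾`, encoded by their coefficients. -/
noncomputable def formDeriv : (ℕ →₀ K) →+ (ℕ →₀ K) :=
  Finsupp.mapRange.addMonoidHom (derivAddHom K) + Finsupp.mapDomain.addMonoidHom Nat.succ

theorem formDeriv_zero (ξ : ℕ →₀ K) : formDeriv K ξ 0 = Differential.deriv (ξ 0) := by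
  simp [formDeriv, derivAddHom, Finsupp.mapDomain_of_notMem_range]

theorem formDeriv_succ (ξ : ℕ →₀ K) (j : ℕ) :
    formDeriv K ξ (j + 1) = Differential.deriv (ξ (j + 1)) + ξ j := by
  simp [formDeriv, derivAddHom, Finsupp.mapDomain_apply Nat.succ_injective]

theorem IsConnection.linearCombination_formDeriv {nabla : V →+ V} (h : IsConnection K nabla)
    (x : V) (ξ : ℕ →₀ K) :
    Finsupp.linearCombination K (fun j => nabla^[j] x) (formDeriv K ξ) =
      nabla (Finsupp.linearCombination K (fun j => nabla^[j] x) ξ) := by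
  induction ξ using Finsupp.induction_linear with
  | zero => simp
  | add f g hf hg => simp only [map_add, hf, hg]
  | single j c =>
    simp [formDeriv, derivAddHom, h.leibniz, Function.iterate_succ_apply']

end LinearForms

section Descent

/-- A linear retraction of `E` onto `L`, applied to the coefficients, turns an `E`-combination of
`L`-rational vectors into an `L`-combination. -/
theorem mem_span_of_mem_span_extension {L E ι : Type*} [Field L] [Field E] [Algebra L E]
    {S : Set (ι →₀ E)} (hS : ∀ s ∈ S, ∀ j, s j ∈ Set.range (algebraMap L E)) {ξ : ι →₀ E}
    (hξ : ∀ j, ξ j ∈ Set.range (algebraMap L E)) (h : ξ ∈ Submodule.span E S) :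
    ξ ∈ Submodule.span L S := by
  obtain ⟨ρ, hρ⟩ := LinearMap.exists_leftInverse_of_injective (Algebra.linearMap L E)
    (LinearMap.ker_eq_bot.mpr (algebraMap L E).injective)
  let R : (ι →₀ E) →ₗ[L] (ι →₀ E) :=
    Finsupp.mapRange.linearMap ((Algebra.linearMap L E).comp ρ)
  have hR_smul : ∀ (c : E) (s : ι →₀ E), (∀ j, s j ∈ Set.range (algebraMap L E)) →
      R (c • s) = ρ c • s := by
    intro c s hs
    ext j
    obtain ⟨a, ha⟩ := hs j
    have hswap : c • s j = a • c := by rw [← ha, smul_eq_mul, Algebra.smul_def, mul_comm]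
    simp only [R, Finsupp.mapRange.linearMap_apply, Finsupp.mapRange_apply, Finsupp.smul_apply,
      LinearMap.comp_apply, hswap, map_smul, Algebra.linearMap_apply]
    rw [← ha, Algebra.smul_def, Algebra.smul_def, mul_comm]
  have hR_mem : R ξ ∈ Submodule.span L S := by
    clear hξ
    induction h using Submodule.closure_induction with
    | zero => simp
    | add x y _ _ hx hy => rw [map_add]; exact add_mem hx hy
    | smul_mem c s hs =>
      rw [hR_smul c s (hS s hs)]
      exact Submodule.smul_mem _ _ (Submodule.subset_span hs)
  have hρ_one : ρ 1 = 1 := by simpa using LinearMap.congr_fun hρ 1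
  rwa [← one_smul E ξ, hR_smul 1 ξ hξ, hρ_one, one_smul] at hR_mem

end Descent

section KaehlerIndependence

theorem formallyEtale_of_isAlgebraic (A E : Type*) [CommRing A] [IsDomain A] [CharZero A]
    [Field E] [Algebra A E] [FaithfulSMul A E] [Algebra.IsAlgebraic A E] :
    Algebra.FormallyEtale A E := by
  let _ := FractionRing.liftAlgebra A E
  have : Algebra.IsAlgebraic (FractionRing A) E :=
    Algebra.IsAlgebraic.extendScalars (IsFractionRing.injective A _)
  have : CharZero (FractionRing A) :=
    charZero_of_injective_algebraMap (IsFractionRing.injective A (FractionRing A))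
  have : Algebra.FormallyEtale (FractionRing A) E := .of_isSeparable _ E
  have : Algebra.FormallyEtale A (FractionRing A) := .of_isLocalization (nonZeroDivisors _)
  exact .comp _ (FractionRing A) _

variable {F E ι : Type*} [Field F] [CharZero F] [Field E] [Algebra F E] {x : ι → E}

theorem linearIndependent_D_of_isTranscendenceBasis (hx : IsTranscendenceBasis F x) :
    LinearIndependent E fun i => KaehlerDifferential.D F E (x i) := by
  let _ : Algebra (MvPolynomial ι F) E := (MvPolynomial.aeval x).toRingHom.toAlgebra
  have : IsScalarTower F (MvPolynomial ι F) E :=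
    IsScalarTower.of_algebraMap_eq fun a => ((MvPolynomial.aeval x).commutes a).symm
  have : FaithfulSMul (MvPolynomial ι F) E :=
    (faithfulSMul_iff_algebraMap_injective _ _).mpr hx.1
  have := hx.isAlgebraic
  have : Algebra.IsAlgebraic (MvPolynomial ι F) E :=
    Algebra.IsAlgebraic.of_ringHom_of_comp_eq (S := Algebra.adjoin F (Set.range x))
      hx.1.aevalEquiv (RingHom.id E) hx.1.aevalEquiv.surjective Function.injective_id
      (RingHom.ext fun p => by simp [RingHom.algebraMap_toAlgebra])
  have := formallyEtale_of_isAlgebraic (MvPolynomial ι F) E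
  have hbasis := ((KaehlerDifferential.mvPolynomialBasis F ι).baseChange E).linearIndependent.map'
    (KaehlerDifferential.tensorKaehlerEquivOfFormallyEtale F (MvPolynomial ι F) E).toLinearMap
    (LinearEquiv.ker _)
  have hbasis_apply : (fun i => KaehlerDifferential.D F E (x i)) = fun i =>
      KaehlerDifferential.tensorKaehlerEquivOfFormallyEtale F (MvPolynomial ι F) E
        ((KaehlerDifferential.mvPolynomialBasis F ι).baseChange E i) := by
    funext i
    simp [KaehlerDifferential.mvPolynomialBasis_apply, RingHom.algebraMap_toAlgebra]
  rw [hbasis_apply]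
  exact hbasis

theorem linearIndependent_D_of_algebraicIndependent (hx : AlgebraicIndependent F x) :
    LinearIndependent E fun i => KaehlerDifferential.D F E (x i) := by
  obtain ⟨t, hst, ht⟩ := exists_isTranscendenceBasis_superset hx.to_subtype_range
  exact (linearIndependent_D_of_isTranscendenceBasis ht).comp
    (fun i => (⟨x i, hst (Set.mem_range_self i)⟩ : t))
    fun i j h => hx.injective (Subtype.ext_iff.mp h)

end KaehlerIndependence

theorem D_mem_span_of_mem_adjoin {F E : Type*} [Field F] [Field E] [Algebra F E] {S : Set E}
    {x : E} (hx : x ∈ IntermediateField.adjoin F S) :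
    KaehlerDifferential.D F E x ∈ Submodule.span E (KaehlerDifferential.D F E '' S) := by
  induction hx using IntermediateField.adjoin_induction with
  | mem x hx => exact Submodule.subset_span ⟨x, hx, rfl⟩
  | algebraMap a => simp
  | add x y _ _ hx hy => rw [map_add]; exact add_mem hx hy
  | inv x _ hx => rw [Derivation.leibniz_inv]; exact Submodule.smul_mem _ _ hx
  | mul x y _ _ hx hy =>
    rw [Derivation.leibniz]
    exact add_mem (Submodule.smul_mem _ _ hy) (Submodule.smul_mem _ _ hx)

theorem derivation_aeval {R S M σ : Type*} [CommRing R] [CommRing S] [Algebra R S]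
    [AddCommGroup M] [Module R M] [Module S M] (d : Derivation R S M) (x : σ → S)
    (f : MvPolynomial σ R) :
    d (MvPolynomial.aeval x f) =
      ∑ w ∈ f.vars, MvPolynomial.aeval x (MvPolynomial.pderiv w f) • d (x w) := by
  classical
  suffices h : ∀ g ∈ MvPolynomial.supported R (f.vars : Set σ), d (MvPolynomial.aeval x g) =
      ∑ w ∈ f.vars, MvPolynomial.aeval x (MvPolynomial.pderiv w g) • d (x w) from
    h f f.mem_supported_vars
  intro g hg
  induction hg using Algebra.adjoin_induction with
  | mem g hg =>
    obtain ⟨w, hw, rfl⟩ := hg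
    rw [Finset.sum_eq_single_of_mem w hw fun b _ hb => by
      rw [MvPolynomial.pderiv_X_of_ne hb.symm, map_zero, zero_smul]]
    simp
  | algebraMap a => simp [MvPolynomial.algebraMap_eq]
  | add g h _ _ hg hh => simp only [map_add, add_smul, Finset.sum_add_distrib, hg, hh]
  | mul g h _ _ hg hh =>
    simp only [map_mul, Derivation.leibniz, map_add, smul_eq_mul, add_smul, mul_smul,
      Finset.sum_add_distrib, ← Finset.smul_sum, hg, hh]

section PolynomialLemmas

open MvPolynomial

theorem derivation_mem_of_mem_adjoin {k R B : Type*} [CommRing k] [CommRing R] [CommRing B]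
    [Algebra k B] [Algebra R B] (d : Derivation k B B) {s : Set B} {T : Subalgebra R B}
    (hs : s ⊆ T) (hR : ∀ a, d (algebraMap R B a) ∈ T) (hd : ∀ x ∈ s, d x ∈ T) {f : B}
    (hf : f ∈ Algebra.adjoin R s) : d f ∈ T := by
  have hle : Algebra.adjoin R s ≤ T := Algebra.adjoin_le hs
  induction hf using Algebra.adjoin_induction with
  | mem x hx => exact hd x hx
  | algebraMap a => exact hR a
  | add x y _ _ hx hy => rw [map_add]; exact add_mem hx hy
  | mul x y hx hy hx' hy' =>
    rw [Derivation.leibniz]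
    exact add_mem (mul_mem (hle hx) hy') (mul_mem (hle hy) hx')

variable {τ R : Type*} [CommRing R]

theorem pderiv_mem_supported {s : Set τ} {f : MvPolynomial τ R} (hf : f ∈ supported R s) (i : τ) :
    pderiv i f ∈ supported R s := by
  classical
  refine derivation_mem_of_mem_adjoin (pderiv i) Algebra.subset_adjoin (fun a => ?_) ?_ hf
  · rw [algebraMap_eq, pderiv_C]
    exact zero_mem _
  · rintro _ ⟨w, -, rfl⟩
    by_cases h : w = i
    · rw [h, pderiv_X_self]
      exact one_mem _
    · rw [pderiv_X_of_ne h]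
      exact zero_mem _

theorem aeval_congr_of_mem_supported {K : Type*} [CommRing K] [Algebra R K] {s : Set τ}
    {a b : τ → K} (hab : ∀ w ∈ s, a w = b w) {f : MvPolynomial τ R} (hf : f ∈ supported R s) :
    aeval a f = aeval b f :=
  eval₂Hom_congr' rfl (fun i hi _ => hab i (mem_supported.mp hf hi)) rfl

variable [IsDomain R]

theorem degreeOf_le_of_dvd {p q : MvPolynomial τ R} (h : p ∣ q) (hq : q ≠ 0) (i : τ) :
    p.degreeOf i ≤ q.degreeOf i := by
  obtain ⟨g, rfl⟩ := h
  rw [degreeOf_mul_eq (left_ne_zero_of_mul hq) (right_ne_zero_of_mul hq)]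
  exact Nat.le_add_right _ _

theorem vars_subset_of_dvd {p q : MvPolynomial τ R} (h : p ∣ q) (hq : q ≠ 0) :
    p.vars ⊆ q.vars := by
  intro i hi
  rw [mem_vars_iff_degreeOf_ne_zero] at hi ⊢
  have := degreeOf_le_of_dvd h hq i
  omega

theorem not_dvd_pderiv [CharZero R] {p : MvPolynomial τ R} {i : τ} (hi : i ∈ p.vars) :
    ¬ p ∣ pderiv i p := by
  intro h
  have hpos : 0 < p.degreeOf i := Nat.pos_of_ne_zero (mem_vars_iff_degreeOf_ne_zero.mp hi)
  have hlt : (pderiv i p).degreeOf i < p.degreeOf i := by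
    refine (degreeOf_lt_iff hpos).mpr fun m hm => ?_
    rw [mem_support_iff, coeff_pderiv] at hm
    have hm' := monomial_le_degreeOf i (mem_support_iff.mpr (left_ne_zero_of_mul hm))
    rw [Finsupp.add_apply, Finsupp.single_eq_same] at hm'
    omega
  have hne : pderiv i p ≠ 0 := by
    obtain ⟨m, hm, him⟩ := (mem_vars_iff_mem_support i).mp hi
    have hle : Finsupp.single i 1 ≤ m :=
      Finsupp.single_le_iff.mpr (Nat.one_le_iff_ne_zero.mpr (Finsupp.mem_support_iff.mp him))
    refine ne_zero_iff.mpr ⟨m - Finsupp.single i 1, ?_⟩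
    rw [coeff_pderiv, tsub_add_cancel_of_le hle]
    exact mul_ne_zero (mem_support_iff.mp hm) (Nat.cast_add_one_ne_zero _)
  exact hlt.not_ge (degreeOf_le_of_dvd h hne i)

end PolynomialLemmas

namespace DiffPoly

open MvPolynomial

variable {σ F : Type*}

section Initial

variable [CommRing F]

theorem initial_mem_supported {A : DiffPoly σ F} {s : Set (σ × ℕ)} (hA : A ∈ supported F s)
    (v : σ × ℕ) : initial A v ∈ supported F (s \ {v}) := by
  classical
  refine sum_mem fun m hm => ?_
  have hm : m ∈ A.support := (Finset.mem_filter.mp hm).1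
  rw [mem_supported, vars_monomial (mem_support_iff.mp hm), Finsupp.support_erase]
  intro w hw
  obtain ⟨hwv, hwm⟩ := Finset.mem_erase.mp hw
  exact ⟨mem_supported.mp hA ((mem_vars_iff_mem_support w).mpr ⟨m, hm, hwm⟩), hwv⟩

theorem initial_ne_zero {A : DiffPoly σ F} (hA : A ≠ 0) (v : σ × ℕ) : initial A v ≠ 0 := by
  classical
  obtain ⟨m, hm, hmax⟩ := Finset.exists_mem_eq_sup A.support (support_nonempty.mpr hA) fun m => m v
  rw [← degreeOf_eq_sup] at hmax
  refine ne_zero_iff.mpr ⟨m.erase v, ?_⟩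
  rw [initial, coeff_sum, Finset.sum_eq_single_of_mem m (Finset.mem_filter.mpr ⟨hm, hmax.symm⟩)]
  · rw [coeff_monomial, if_pos rfl]
    exact mem_support_iff.mp hm
  · intro m' hm' hne
    rw [coeff_monomial, if_neg]
    intro h
    refine hne (Finsupp.ext fun w => ?_)
    by_cases hw : w = v
    · rw [hw, (Finset.mem_filter.mp hm').2, hmax]
    · simpa only [Finsupp.erase_ne hw] using DFunLike.congr_fun h w

theorem not_dvd_initial [IsDomain F] {A : DiffPoly σ F} {v : σ × ℕ} (hv : v ∈ A.vars) :
    ¬ A ∣ initial A v := by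
  intro h
  have hA : A ≠ 0 := by rintro rfl; simp at hv
  have hvI := vars_subset_of_dvd h (initial_ne_zero hA v) hv
  exact (mem_supported.mp (initial_mem_supported (mem_supported_vars A) v) hvI).2 rfl

end Initial

section Ranking

variable {r : σ × ℕ → σ × ℕ → Prop}

theorem IsRanking.trans (hr : IsRanking r) {a b c : σ × ℕ} (hab : r a b) (hbc : r b c) :
    r a c :=
  have := hr.isStrictTotalOrder
  _root_.trans hab hbc

theorem IsRanking.monotone_setOf_lt (hr : IsRanking r) (v : σ × ℕ) :
    Monotone fun k => {w | r w (v.1, v.2 + k)} :=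
  monotone_nat_of_le_succ fun _ _ hw => hr.trans hw (hr.lt_deriv _)

variable [CommRing F] {A : DiffPoly σ F} {v : σ × ℕ}

theorem IsLeader.le_of_mem_vars (hr : IsRanking r) (hv : IsLeader r A v) {k : ℕ}
    (hk : (v.1, k) ∈ A.vars) : k ≤ v.2 := by
  by_contra! hlt
  obtain ⟨d, rfl⟩ := Nat.exists_eq_add_of_lt hlt
  have := hr.isStrictTotalOrder
  have hlower : r v (v.1, v.2 + d + 1) :=
    hr.monotone_setOf_lt v (Nat.le_add_left 1 d) (hr.lt_deriv v)
  exact asymm_of r hlower (hv.2 _ hk fun h => hlt.ne' (congrArg Prod.snd h))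

variable (F) in
/-- The ring of differential polynomials that are partially reduced with respect to a
differential polynomial with leader `v`: no proper derivative of `v` occurs in them. -/
noncomputable def partiallyReduced (v : σ × ℕ) : Subalgebra F (DiffPoly σ F) :=
  supported F {w | w.1 = v.1 → w.2 ≤ v.2}

theorem IsLeader.mem_partiallyReduced (hr : IsRanking r) (hv : IsLeader r A v) :
    A ∈ partiallyReduced F v := by
  refine mem_supported.mpr fun w hw hw1 => hv.le_of_mem_vars hr ?_
  rwa [← hw1]

variable [Differential F]

theorem deriv_mem_supported {s t : Set (σ × ℕ)} (hst : s ⊆ t)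
    (h : ∀ w ∈ s, (w.1, w.2 + 1) ∈ t) {f : DiffPoly σ F} (hf : f ∈ supported F s) :
    Differential.deriv f ∈ supported F t := by
  refine derivation_mem_of_mem_adjoin Differential.deriv ?_ (fun a => ?_) ?_ hf
  · exact (Set.image_mono hst).trans Algebra.subset_adjoin
  · rw [algebraMap_eq, deriv_C]
    exact Subalgebra.algebraMap_mem _ _
  · rintro _ ⟨w, hw, rfl⟩
    rw [deriv_X]
    exact Algebra.subset_adjoin ⟨_, h w hw, rfl⟩

theorem deriv_sub_mul_separant_mem_supported {s t : Set (σ × ℕ)} (hvst : insert v s ⊆ t)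
    (h : ∀ w ∈ s, (w.1, w.2 + 1) ∈ t) (hA : A ∈ supported F (insert v s)) :
    Differential.deriv A - X (v.1, v.2 + 1) * separant A v ∈ supported F t := by
  classical
  let d : Derivation ℤ (DiffPoly σ F) (DiffPoly σ F) := Differential.deriv -
    (X (v.1, v.2 + 1) : DiffPoly σ F) • (pderiv v).restrictScalars ℤ
  have hd (f : DiffPoly σ F) : d f = Differential.deriv f - X (v.1, v.2 + 1) * pderiv v f := rfl
  refine derivation_mem_of_mem_adjoin d ?_ (fun a => ?_) ?_ hA
  · exact (Set.image_mono hvst).trans Algebra.subset_adjoin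
  · rw [hd, algebraMap_eq, deriv_C, pderiv_C, mul_zero, sub_zero]
    exact Subalgebra.algebraMap_mem _ _
  · rintro _ ⟨w, hw, rfl⟩
    rw [hd, deriv_X]
    by_cases hwv : w = v
    · rw [hwv, pderiv_X_self, mul_one, sub_self]
      exact zero_mem _
    · rw [pderiv_X_of_ne hwv, mul_zero, sub_zero]
      exact Algebra.subset_adjoin ⟨_, h w (hw.resolve_left hwv), rfl⟩

theorem IsLeader.iterate_deriv_mem_supported (hr : IsRanking r) (hv : IsLeader r A v) (k : ℕ) :
    (⇑Differential.deriv)^[k] A ∈ supported F {w | r w (v.1, v.2 + (k + 1))} := by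
  induction k with
  | zero =>
    refine mem_supported.mpr fun w hw => ?_
    by_cases hwv : w = v
    · exact hwv ▸ hr.lt_deriv v
    · exact hr.trans (hv.2 w hw hwv) (hr.lt_deriv v)
  | succ k ih =>
    rw [Function.iterate_succ_apply']
    exact deriv_mem_supported (s := {w | r w (v.1, v.2 + (k + 1))})
      (fun w hw => hr.trans hw (hr.lt_deriv _)) (fun w hw => hr.deriv_lt_deriv _ _ hw) ih

theorem IsLeader.separant_mem_supported (hr : IsRanking r) (hv : IsLeader r A v) :
    separant A v ∈ supported F {w | r w (v.1, v.2 + 1)} :=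
  pderiv_mem_supported (hv.iterate_deriv_mem_supported hr 0) v

theorem IsLeader.iterate_deriv_sub_mul_separant_mem_supported (hr : IsRanking r)
    (hv : IsLeader r A v) (k : ℕ) :
    (⇑Differential.deriv)^[k + 1] A - X (v.1, v.2 + (k + 1)) * separant A v ∈
      supported F {w | r w (v.1, v.2 + (k + 1))} := by
  have hmono (l : ℕ) : {w | r w (v.1, v.2 + l)} ⊆ {w | r w (v.1, v.2 + (l + 1))} :=
    fun w hw => hr.trans hw (hr.lt_deriv _)
  have hshift (l : ℕ) : ∀ w ∈ {w | r w (v.1, v.2 + l)},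
      (w.1, w.2 + 1) ∈ {w | r w (v.1, v.2 + (l + 1))} := fun w hw => hr.deriv_lt_deriv _ _ hw
  induction k with
  | zero =>
    refine deriv_sub_mul_separant_mem_supported (s := {w | r w (v.1, v.2 + 0)})
      (Set.insert_subset (hr.lt_deriv v) (hmono 0)) (hshift 0) (mem_supported.mpr fun w hw => ?_)
    exact or_iff_not_imp_left.mpr (hv.2 w hw)
  | succ k ih =>
    have hS : Differential.deriv (separant A v) ∈ supported F {w | r w (v.1, v.2 + (k + 2))} :=
      supported_mono (hr.monotone_setOf_lt v (Nat.le_add_left 2 k))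
        (deriv_mem_supported (hmono 1) (hshift 1) (hv.separant_mem_supported hr))
    have hX : (X (v.1, v.2 + (k + 1)) : DiffPoly σ F) ∈
        supported F {w | r w (v.1, v.2 + (k + 2))} :=
      Algebra.subset_adjoin ⟨_, hr.lt_deriv _, rfl⟩
    convert add_mem (deriv_mem_supported (hmono _) (hshift _) ih) (mul_mem hX hS) using 1
    rw [Function.iterate_succ_apply' _ (k + 1), map_sub, Derivation.leibniz, deriv_X]
    simp only [smul_eq_mul, add_assoc]
    ring

end Ranking

section Saturation

variable {r : σ × ℕ → σ × ℕ → Prop} [Field F] [Differential F] {A : DiffPoly σ F} {v : σ × ℕ}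
  {K : Type*} [Field K] [Algebra F K]

/- For `k ≥ 1` the equation `A^(k) = 0` is linear in `v^(k)` with leading coefficient the
separant, so the derivatives of `v` can be chosen one after the other. -/
theorem exists_aeval_iterate_deriv_eq_zero (hr : IsRanking r) (hv : IsLeader r A v)
    {a : σ × ℕ → K} (hA : aeval a A = 0) (hS : aeval a (separant A v) ≠ 0) (N : ℕ) :
    ∃ b : σ × ℕ → K, (∀ w, (w.1 = v.1 → w.2 ≤ v.2) → a w = b w) ∧
      ∀ k ≤ N, aeval b ((⇑Differential.deriv)^[k] A) = 0 := by
  classical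
  induction N with
  | zero => exact ⟨a, fun _ _ => rfl, fun k hk => by rwa [Nat.le_zero.mp hk]⟩
  | succ N ih =>
    obtain ⟨b, hab, hb⟩ := ih
    set z : σ × ℕ := (v.1, v.2 + (N + 1))
    set T := (⇑Differential.deriv)^[N + 1] A - X z * separant A v with hT
    have hSb : aeval b (separant A v) ≠ 0 := by
      rwa [separant, ← aeval_congr_of_mem_supported hab
        (pderiv_mem_supported (hv.mem_partiallyReduced hr) v)]
    set c := Function.update b z (-aeval b T / aeval b (separant A v)) with hc
    have hbc {l : ℕ} (hl : l ≤ N + 1) {f : DiffPoly σ F}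
        (hf : f ∈ supported F {w | r w (v.1, v.2 + l)}) : aeval b f = aeval c f := by
      refine aeval_congr_of_mem_supported (fun w hw => ?_)
        (supported_mono (hr.monotone_setOf_lt v hl) hf)
      have := hr.isStrictTotalOrder
      rw [hc, Function.update_of_ne (ne_of_irrefl hw)]
    refine ⟨c, fun w hw => ?_, fun k hk => ?_⟩
    · rw [hab w hw, hc, Function.update_of_ne]
      rintro rfl
      exact absurd (hw rfl) (Nat.not_le.mpr (Nat.lt_add_of_pos_right N.succ_pos))
    · obtain hk | rfl := Nat.le_succ_iff.mp hk
      · rw [← hbc (Nat.succ_le_succ hk) (hv.iterate_deriv_mem_supported hr k), hb k hk]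
      · rw [sub_eq_iff_eq_add.mp hT.symm, map_add, map_mul, aeval_X,
          ← hbc le_rfl (hv.iterate_deriv_sub_mul_separant_mem_supported hr N),
          ← hbc (Nat.le_add_left 1 N) (hv.separant_mem_supported hr), hc, Function.update_self]
        field_simp
        ring

theorem exists_aeval_eq_zero_of_mem_diffIdeal {g : DiffPoly σ F} (hg : g ∈ diffIdeal A) :
    ∃ N, ∀ b : σ × ℕ → K,
      (∀ k ≤ N, aeval b ((⇑Differential.deriv)^[k] A) = 0) → aeval b g = 0 := by
  induction hg using Submodule.span_induction with
  | mem x hx => obtain ⟨k, rfl⟩ := hx; exact ⟨k, fun b hb => hb k le_rfl⟩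
  | zero => exact ⟨0, fun b _ => map_zero _⟩
  | add x y _ _ hx hy =>
    obtain ⟨M, hM⟩ := hx
    obtain ⟨N, hN⟩ := hy
    refine ⟨max M N, fun b hb => ?_⟩
    rw [map_add, hM b fun k hk => hb k (le_max_of_le_left hk),
      hN b fun k hk => hb k (le_max_of_le_right hk), add_zero]
  | smul c x _ hx =>
    obtain ⟨N, hN⟩ := hx
    exact ⟨N, fun b hb => by rw [smul_eq_mul, map_mul, hN b hb, mul_zero]⟩

theorem aeval_eq_zero_of_mem_sat (hr : IsRanking r) (hv : IsLeader r A v) {a : σ × ℕ → K}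
    (hA : aeval a A = 0) (hS : aeval a (separant A v) ≠ 0) (hI : aeval a (initial A v) ≠ 0)
    {f : DiffPoly σ F} (hf : f ∈ sat A v) (hred : f ∈ partiallyReduced F v) :
    aeval a f = 0 := by
  obtain ⟨m, hm⟩ := hf
  obtain ⟨N, hN⟩ := exists_aeval_eq_zero_of_mem_diffIdeal (K := K) hm
  obtain ⟨b, hab, hb⟩ := exists_aeval_iterate_deriv_eq_zero hr hv hA hS N
  have hAred : A ∈ partiallyReduced F v := hv.mem_partiallyReduced hr
  have hSred : separant A v ∈ partiallyReduced F v := pderiv_mem_supported hAred v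
  have hIred : initial A v ∈ partiallyReduced F v :=
    supported_mono Set.sdiff_subset (initial_mem_supported hAred v)
  have hzero := hN b hb
  rw [← aeval_congr_of_mem_supported hab
    (mul_mem (pow_mem (mul_mem hSred hIred) m) hred), map_mul, map_pow, map_mul] at hzero
  exact (mul_eq_zero.mp hzero).resolve_left (pow_ne_zero m (mul_ne_zero hS hI))

theorem dvd_of_mem_sat [CharZero F] (hr : IsRanking r) (hv : IsLeader r A v)
    (hA : Irreducible A) {f : DiffPoly σ F} (hf : f ∈ sat A v)
    (hred : f ∈ partiallyReduced F v) : A ∣ f := by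
  have hprime : (Ideal.span {A}).IsPrime :=
    (Ideal.span_singleton_prime hA.ne_zero).mpr hA.prime
  let quot := DiffPoly σ F ⧸ Ideal.span {A}
  let point : σ × ℕ → FractionRing quot := fun w => algebraMap quot _ (Ideal.Quotient.mk _ (X w))
  have haeval (g : DiffPoly σ F) :
      aeval point g = algebraMap quot (FractionRing quot) (Ideal.Quotient.mk _ g) := by
    have : aeval point = (IsScalarTower.toAlgHom F quot (FractionRing quot)).comp
        (Ideal.Quotient.mkₐ F (Ideal.span {A})) := algHom_ext fun w => aeval_X _ _
    exact DFunLike.congr_fun this g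
  have hzero (g : DiffPoly σ F) : aeval point g = 0 ↔ A ∣ g := by
    rw [haeval, FaithfulSMul.algebraMap_eq_zero_iff, Ideal.Quotient.eq_zero_iff_mem,
      Ideal.mem_span_singleton]
  exact (hzero f).mp (aeval_eq_zero_of_mem_sat hr hv ((hzero A).mpr dvd_rfl)
    ((hzero _).not.mpr (not_dvd_pderiv hv.1)) ((hzero _).not.mpr (not_dvd_initial hv.1)) hf hred)

end Saturation

section Order

variable [CommRing F] {i : σ} {f : DiffPoly σ F}

theorem le_ord {k : ℕ} (hk : (i, k) ∈ f.vars) : (k : WithBot ℕ) ≤ ord i f := by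
  classical
  have hk' : (i, k) ∈ f.vars.filter fun v => v.1 = i := Finset.mem_filter.mpr ⟨hk, rfl⟩
  exact (Finset.le_sup (f := fun v : σ × ℕ => (v.2 : WithBot ℕ)) hk').trans_eq rfl

theorem ord_eq_bot_iff : ord i f = ⊥ ↔ ∀ k, (i, k) ∉ f.vars := by
  refine ⟨fun h k hk => WithBot.coe_ne_bot (le_bot_iff.mp ((le_ord hk).trans_eq h)), fun h => ?_⟩
  classical
  rw [ord, Finset.filter_false_of_mem, Finset.sup_empty]
  rintro ⟨j, k⟩ hk rfl
  exact h k hk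

theorem exists_ord_eq (hf : ∃ k, (i, k) ∈ f.vars) : ∃ k, (i, k) ∈ f.vars ∧ ord i f = k := by
  classical
  obtain ⟨l, hl⟩ := hf
  have hne : (f.vars.filter fun v => v.1 = i).Nonempty := ⟨_, Finset.mem_filter.mpr ⟨hl, rfl⟩⟩
  obtain ⟨w, hw, hsup⟩ := Finset.exists_mem_eq_sup _ hne fun v => (v.2 : WithBot ℕ)
  obtain ⟨hwf, rfl⟩ := Finset.mem_filter.mp hw
  exact ⟨w.2, hwf, hsup⟩

theorem ord_eq_coe_iff {n : ℕ} :
    ord i f = n ↔ (i, n) ∈ f.vars ∧ ∀ k, (i, k) ∈ f.vars → k ≤ n := by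
  have hmax {k l : ℕ} (hk : ord i f = k) (hl : (i, l) ∈ f.vars) : l ≤ k :=
    WithBot.coe_le_coe.mp ((le_ord hl).trans_eq hk)
  constructor
  · intro h
    have hf : ∃ k, (i, k) ∈ f.vars := by
      by_contra! hempty
      exact WithBot.bot_ne_coe ((ord_eq_bot_iff.mpr hempty).symm.trans h)
    obtain ⟨k, hk, hord⟩ := exists_ord_eq hf
    obtain rfl : k = n := WithBot.coe_injective (hord.symm.trans h)
    exact ⟨hk, fun l => hmax h⟩
  · rintro ⟨hn, hle⟩
    obtain ⟨k, hk, hord⟩ := exists_ord_eq ⟨n, hn⟩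
    rw [hord, (hle k hk).antisymm (hmax hord hn)]

theorem IsLeader.ord_eq {r : σ × ℕ → σ × ℕ → Prop} (hr : IsRanking r) {v : σ × ℕ}
    (hv : IsLeader r f v) : ord v.1 f = v.2 :=
  ord_eq_coe_iff.mpr ⟨hv.1, fun _ hk => hv.le_of_mem_vars hr hk⟩

theorem ord_of_vars_subset_singleton (h : f.vars ⊆ {(i, 0)}) (hf : f.vars.Nonempty) :
    ord i f = (0 : ℕ) ∧ ∀ j ≠ i, ord j f = ⊥ := by
  have hvars (w : σ × ℕ) (hw : w ∈ f.vars) : w = (i, 0) := Finset.mem_singleton.mp (h hw)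
  obtain ⟨w, hw⟩ := hf
  exact ⟨ord_eq_coe_iff.mpr ⟨hvars w hw ▸ hw, fun k hk => (congrArg Prod.snd (hvars _ hk)).le⟩,
    fun j hj => ord_eq_bot_iff.mpr fun k hk => hj (congrArg Prod.fst (hvars _ hk))⟩

end Order

end DiffPoly

theorem derivation_mem_span_of_aeval_eq_zero {R E M σ : Type*} [CommRing R] [Field E] [Algebra R E]
    [AddCommGroup M] [Module R M] [Module E M] (d : Derivation R E M) {x : σ → E}
    {f : MvPolynomial σ R} (hf : MvPolynomial.aeval x f = 0) {v : σ}
    (hv : MvPolynomial.aeval x (MvPolynomial.pderiv v f) ≠ 0) :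
    d (x v) ∈ Submodule.span E ((fun w => d (x w)) '' (f.vars \ {v})) := by
  classical
  have hvf : v ∈ f.vars := by
    contrapose! hv
    rw [MvPolynomial.pderiv_eq_zero_of_notMem_vars hv, map_zero]
  have hsum := derivation_aeval d x f
  rw [hf, map_zero, ← Finset.add_sum_erase _ _ hvf] at hsum
  rw [← Submodule.smul_mem_iff _ hv, eq_neg_of_add_eq_zero_left hsum.symm]
  refine neg_mem (sum_mem fun w hw => Submodule.smul_mem _ _ (Submodule.subset_span ⟨w, ?_, rfl⟩))
  exact ⟨Finset.mem_of_mem_erase hw, Finset.ne_of_mem_erase hw⟩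

namespace DiffPoly

open MvPolynomial

section Generic

variable {σ F E : Type*} [Field F] [Differential F] [Field E] [Differential E] [Algebra F E]
  {r : σ × ℕ → σ × ℕ → Prop} {A : DiffPoly σ F} {v : σ × ℕ} {η : σ → E}

theorem evalAt_eq_zero_of_generic (hη : vanishingIdeal F η = sat A v) : evalAt η A = 0 := by
  change A ∈ vanishingIdeal F η
  rw [hη]
  refine ⟨0, ?_⟩
  rw [pow_zero, one_mul]
  exact Ideal.subset_span ⟨0, rfl⟩

variable [CharZero F]

theorem evalAt_eq_zero_iff_dvd (hr : IsRanking r) (hv : IsLeader r A v) (hA : Irreducible A)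
    (hη : vanishingIdeal F η = sat A v) {f : DiffPoly σ F} (hf : f ∈ partiallyReduced F v) :
    evalAt η f = 0 ↔ A ∣ f := by
  refine ⟨fun h => dvd_of_mem_sat hr hv hA (hη ▸ (h : f ∈ vanishingIdeal F η)) hf, ?_⟩
  rintro ⟨g, rfl⟩
  rw [map_mul, evalAt_eq_zero_of_generic hη, zero_mul]

theorem evalAt_pderiv_ne_zero (hr : IsRanking r) (hv : IsLeader r A v) (hA : Irreducible A)
    (hη : vanishingIdeal F η = sat A v) {w : σ × ℕ} (hw : w ∈ A.vars) :
    evalAt η (pderiv w A) ≠ 0 := by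
  rw [ne_eq, evalAt_eq_zero_iff_dvd hr hv hA hη
    (pderiv_mem_supported (hv.mem_partiallyReduced hr) w)]
  exact not_dvd_pderiv hw

theorem vars_subset_singleton_of_generic (hr : IsRanking r) (hv : IsLeader r A v)
    (hA : Irreducible A) (hη : vanishingIdeal F η = sat A v) {i : σ} {c : F}
    (hc : η i = algebraMap F E c) : A.vars ⊆ {(i, 0)} := by
  let f : DiffPoly σ F := X (i, 0) - C c
  have hf : f ∈ supported F {((i, 0) : σ × ℕ)} :=
    sub_mem (X_mem_supported.mpr rfl) (Subalgebra.algebraMap_mem _ _)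
  have hf_ne : f ≠ 0 := sub_ne_zero.mpr fun h => by
    simpa using congrArg MvPolynomial.vars h
  have hf_eval : evalAt η f = 0 := by
    rw [map_sub, evalAt, aeval_X, aeval_C, ← hc]
    exact sub_self _
  have hf_reduced : f ∈ partiallyReduced F v :=
    supported_mono (by rintro _ rfl -; exact Nat.zero_le _) hf
  have hdvd := (evalAt_eq_zero_iff_dvd hr hv hA hη hf_reduced).mp hf_eval
  exact fun w hw => Finset.mem_singleton.mpr
    (mem_supported.mp hf (vars_subset_of_dvd hdvd hf_ne hw))

theorem algebraicIndependent_of_generic (hr : IsRanking r) (hv : IsLeader r A v)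
    (hA : Irreducible A) (hη : vanishingIdeal F η = sat A v) :
    AlgebraicIndependent F fun w : {w : σ × ℕ // w.1 = v.1 → w.2 < v.2} =>
      (⇑Differential.deriv)^[w.1.2] (η w.1.1) := by
  refine algebraicIndependent_iff.mpr fun p hp => ?_
  have hsupp : rename Subtype.val p ∈ supported F {w : σ × ℕ | w.1 = v.1 → w.2 < v.2} := by
    rw [supported_eq_range_rename]
    exact ⟨p, rfl⟩
  have hdvd : A ∣ rename Subtype.val p := by
    refine (evalAt_eq_zero_iff_dvd hr hv hA hη ?_).mp ?_
    · exact supported_mono (fun w hw hwv => (hw hwv).le) hsupp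
    · rw [evalAt, aeval_rename]
      exact hp
  by_contra hne
  have hne' : rename Subtype.val p ≠ 0 :=
    (map_ne_zero_iff _ (rename_injective _ Subtype.val_injective)).mpr hne
  exact (mem_supported.mp hsupp (vars_subset_of_dvd hdvd hne' hv.1) rfl).ne rfl

variable {i j : σ}

theorem finrank_orbitSpan_sup_of_generic [DifferentialAlgebra F E] (hr : IsRanking r)
    (hv : IsLeader r A v) (hA : Irreducible A) (hη : vanishingIdeal F η = sat A v)
    (hi : i ≠ v.1) (s : ℕ) :
    Module.finrank E ↥(orbitSpan E (lieDerivative F E) (KaehlerDifferential.D F E (η i)) s ⊔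
      orbitSpan E (lieDerivative F E) (KaehlerDifferential.D F E (η v.1)) v.2) = s + v.2 := by
  let ι : Fin s ⊕ Fin v.2 → {w : σ × ℕ // w.1 = v.1 → w.2 < v.2} :=
    Sum.elim (fun k => ⟨(i, k), fun h => absurd h hi⟩) (fun k => ⟨(v.1, k), fun _ => k.2⟩)
  have hι : Function.Injective ι := by
    rintro (k | k) (l | l) hkl <;> simp_all [ι, Fin.ext_iff, hi.symm]
  refine finrank_orbitSpan_sup ?_
  convert (linearIndependent_D_of_algebraicIndependent
    (algebraicIndependent_of_generic hr hv hA hη)).comp ι hι using 1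
  funext k
  cases k <;> exact iterate_lieDerivative_D _ _

theorem iterate_lieDerivative_D_mem_of_generic [DifferentialAlgebra F E] (hr : IsRanking r)
    (hv : IsLeader r A v) (hA : Irreducible A) (hη : vanishingIdeal F η = sat A v)
    (hij : ∀ l, l = i ∨ l = j) {a b : ℕ} (ha : ∀ k, (i, k) ∈ A.vars → k < a)
    (hb : ord j A = b) :
    (lieDerivative F E)^[b] (KaehlerDifferential.D F E (η j)) ∈
      orbitSpan E (lieDerivative F E) (KaehlerDifferential.D F E (η i)) a ⊔
        orbitSpan E (lieDerivative F E) (KaehlerDifferential.D F E (η j)) b := by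
  obtain ⟨hbA, hb⟩ := ord_eq_coe_iff.mp hb
  have hmem := derivation_mem_span_of_aeval_eq_zero (KaehlerDifferential.D F E)
    (evalAt_eq_zero_of_generic hη) (evalAt_pderiv_ne_zero hr hv hA hη hbA)
  simp only [← iterate_lieDerivative_D] at hmem
  refine Submodule.span_le.mpr ?_ hmem
  rintro _ ⟨⟨l, k⟩, ⟨hk, hne⟩, rfl⟩
  rcases hij l with rfl | rfl
  · exact Submodule.mem_sup_left (iterate_mem_orbitSpan_of_lt (ha k hk))
  · refine Submodule.mem_sup_right (iterate_mem_orbitSpan_of_lt ((hb k hk).lt_of_ne ?_))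
    rintro rfl
    exact hne rfl

theorem hasRelationOrders_of_generic [DifferentialAlgebra F E] (hr : IsRanking r)
    (hv : IsLeader r A v) (hA : Irreducible A) (hη : vanishingIdeal F η = sat A v)
    (hne : i ≠ j) (hij : ∀ l, l = i ∨ l = j) {a b : ℕ} (ha : ord i A = a) (hb : ord j A = b) :
    HasRelationOrders E (lieDerivative F E) (KaehlerDifferential.D F E (η i))
      (KaehlerDifferential.D F E (η j)) a b := by
  wlog hvj : v.1 = j generalizing i j a b
  · exact (this hne.symm (fun l => (hij l).symm) hb ha ((hij v.1).resolve_right hvj)).symm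
  subst hvj
  obtain rfl : v.2 = b := WithBot.coe_injective ((hv.ord_eq hr).symm.trans hb)
  exact (isConnection_lieDerivative F E).hasRelationOrders
    (iterate_lieDerivative_D_mem_of_generic hr hv hA hη hij
      (fun k hk => Nat.lt_succ_of_le ((ord_eq_coe_iff.mp ha).2 k hk)) hb)
    (iterate_lieDerivative_D_mem_of_generic hr hv hA hη (fun l => (hij l).symm)
      (fun k hk => Nat.lt_succ_of_le ((ord_eq_coe_iff.mp hb).2 k hk)) ha)
    (finrank_orbitSpan_sup_of_generic hr hv hA hη hne)

end Generic

end DiffPoly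

theorem hasOrder_of_linearCombination_eq_smul {K V : Type*} [Field K] [AddCommGroup V]
    [Module K V] {nabla : V →+ V} {u y : V} {ξ : ℕ →₀ K} {q : K} {n : ℕ} (hq : q ≠ 0)
    (h : Finsupp.linearCombination K (fun j => nabla^[j] u) ξ = q • y) (hn : ξ n ≠ 0)
    (hlt : ∀ j, n < j → ξ j = 0) : HasOrder K nabla u y n := by
  refine ⟨q⁻¹ * ξ n, mul_ne_zero (inv_ne_zero hq) hn, ?_⟩
  have hy : y - (q⁻¹ * ξ n) • nabla^[n] u =
      q⁻¹ • Finsupp.linearCombination K (fun j => nabla^[j] u) (ξ.erase n) := by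
    rw [← inv_smul_smul₀ hq y, ← h]
    conv_lhs => rw [← Finsupp.single_add_erase n ξ]
    rw [map_add, Finsupp.linearCombination_single, Finsupp.add_apply, Finsupp.single_eq_same,
      Finsupp.erase_same, add_zero, smul_add, mul_smul, add_sub_cancel_left]
  rw [hy, Finsupp.linearCombination_apply]
  refine Submodule.smul_mem _ _ (Submodule.sum_mem _ fun j hj => Submodule.smul_mem _ _
    (iterate_mem_orbitSpan_of_lt ?_))
  rw [Finsupp.support_erase, Finset.mem_erase, Finsupp.mem_support_iff] at hj
  exact lt_of_le_of_ne (not_lt.mp fun hlj => hj.2 (hlt j hlj)) hj.1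

section LinearPolynomials

open MvPolynomial

theorem eq_zero_or_eq_single_of_mem_support {R τ : Type*} [CommSemiring R] {f : MvPolynomial τ R}
    (hf : f.totalDegree ≤ 1) {m : τ →₀ ℕ} (hm : m ∈ f.support) :
    m = 0 ∨ ∃ w, m = Finsupp.single w 1 := by
  have hdeg : m.degree ≤ 1 := (le_totalDegree hm).trans hf
  rcases Nat.le_one_iff_eq_zero_or_eq_one.mp hdeg with h | h
  · exact Or.inl (m.degree_eq_zero_iff.mp h)
  · exact Or.inr ((Finsupp.sum_eq_one_iff m).mp h)

theorem mem_vars_iff_coeff_single_ne_zero {R τ : Type*} [CommSemiring R] {f : MvPolynomial τ R}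
    (hf : f.totalDegree ≤ 1) {w : τ} : w ∈ f.vars ↔ f.coeff (Finsupp.single w 1) ≠ 0 := by
  rw [mem_vars_iff_mem_support]
  constructor
  · rintro ⟨m, hm, hw⟩
    rcases eq_zero_or_eq_single_of_mem_support hf hm with rfl | ⟨z, rfl⟩
    · simp at hw
    · obtain rfl : w = z := by simpa using hw
      exact mem_support_iff.mp hm
  · exact fun h => ⟨_, mem_support_iff.mpr h, by simp⟩

theorem eq_C_add_sum_of_totalDegree_le_one {R τ : Type*} [CommSemiring R] {f : MvPolynomial τ R}
    (hf : f.totalDegree ≤ 1) :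
    f = C (f.coeff 0) + ∑ w ∈ f.vars, C (f.coeff (Finsupp.single w 1)) * X w := by
  classical
  ext m
  simp only [coeff_add, coeff_sum, coeff_C_mul, coeff_C, coeff_X, mul_ite, mul_one, mul_zero]
  by_cases hm : m ∈ f.support
  · rcases eq_zero_or_eq_single_of_mem_support hf hm with rfl | ⟨w, rfl⟩
    · simp
    · have hw : w ∈ f.vars :=
        (mem_vars_iff_coeff_single_ne_zero hf).mpr (mem_support_iff.mp hm)
      simp [Finsupp.single_left_inj, hw, eq_comm (a := (0 : τ →₀ ℕ))]
  · rw [notMem_support_iff.mp hm, ite_eq_right_iff.mpr, Finset.sum_eq_zero, zero_add]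
    · rintro w -
      exact ite_eq_right_iff.mpr (by rintro rfl; exact notMem_support_iff.mp hm)
    · rintro rfl
      exact notMem_support_iff.mp hm

end LinearPolynomials

namespace DiffPoly

section LinearFractions

variable {F : Type*} (E : Type*) [Field F] [Field E] [Algebra F E]

/-- The homogeneous part of degree one of a differential polynomial in one indeterminate, as the
family of its coefficients in an extension `E` of the base field. -/
noncomputable def linearPart (f : DiffPoly Unit F) : ℕ →₀ E :=
  ∑ w ∈ f.vars, Finsupp.single w.2 (algebraMap F E (f.coeff (Finsupp.single w 1)))

variable {E}

theorem linearPart_apply {f : DiffPoly Unit F} (hf : f.totalDegree ≤ 1) (j : ℕ) :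
    linearPart E f j = algebraMap F E (f.coeff (Finsupp.single ((), j) 1)) := by
  rw [linearPart, Finsupp.finsetSum_apply, Finset.sum_eq_single ((), j),
    Finsupp.single_eq_same]
  · rintro ⟨⟨⟩, k⟩ - hk
    exact Finsupp.single_eq_of_ne fun hjk => hk (by rw [hjk])
  · intro hj
    rw [Finsupp.single_eq_same, not_not.mp fun h =>
      hj ((mem_vars_iff_coeff_single_ne_zero hf).mpr h), map_zero]

variable {p q : DiffPoly Unit F} {α : E}

/-- The linear form `p̄ - α q̄` attached to `α = p(u) / q(u)` with `p` and `q` of degree at most one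
and linear parts `p̄` and `q̄`. Its value at `du` is `q(u) dα`, and its value at `u` is
`q(0) α - p(0)`. -/
noncomputable def fractionForm (p q : DiffPoly Unit F) (α : E) : ℕ →₀ E :=
  linearPart E p - α • linearPart E q

theorem fractionForm_apply (hp : p.totalDegree ≤ 1) (hq : q.totalDegree ≤ 1) (j : ℕ) :
    fractionForm p q α j = algebraMap F E (p.coeff (Finsupp.single ((), j) 1)) -
      α * algebraMap F E (q.coeff (Finsupp.single ((), j) 1)) := by
  rw [fractionForm, Finsupp.sub_apply, Finsupp.smul_apply, linearPart_apply hp,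
    linearPart_apply hq, smul_eq_mul]

theorem fractionForm_apply_ne_zero (hp : p.totalDegree ≤ 1) (hq : q.totalDegree ≤ 1)
    (hα : α ∉ Set.range (algebraMap F E)) {j : ℕ} (hj : ((), j) ∈ p.vars ∪ q.vars) :
    fractionForm p q α j ≠ 0 := by
  rw [fractionForm_apply hp hq, sub_ne_zero]
  intro heq
  by_cases hqj : q.coeff (Finsupp.single ((), j) 1) = 0
  · rw [hqj, map_zero, mul_zero, map_eq_zero] at heq
    rw [Finset.mem_union, mem_vars_iff_coeff_single_ne_zero hp,
      mem_vars_iff_coeff_single_ne_zero hq] at hj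
    exact hj.elim (· heq) (· hqj)
  · refine hα ⟨p.coeff (Finsupp.single ((), j) 1) / q.coeff (Finsupp.single ((), j) 1), ?_⟩
    rw [map_div₀, heq, mul_div_cancel_right₀ _ ((map_ne_zero _).mpr hqj)]

theorem fractionForm_apply_eq_zero (hp : p.totalDegree ≤ 1) (hq : q.totalDegree ≤ 1) {j : ℕ}
    (hj : ((), j) ∉ p.vars ∪ q.vars) : fractionForm p q α j = 0 := by
  rw [Finset.mem_union, mem_vars_iff_coeff_single_ne_zero hp,
    mem_vars_iff_coeff_single_ne_zero hq, not_or, not_not, not_not] at hj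
  rw [fractionForm_apply hp hq, hj.1, hj.2, map_zero, mul_zero, sub_zero]

variable [Differential E] {u : E}

theorem evalAt_eq_add_linearCombination_linearPart {f : DiffPoly Unit F}
    (hf : f.totalDegree ≤ 1) :
    evalAt (fun _ => u) f = algebraMap F E (f.coeff 0) +
      Finsupp.linearCombination E (fun j => (⇑Differential.deriv)^[j] u) (linearPart E f) := by
  conv_lhs => rw [eq_C_add_sum_of_totalDegree_le_one hf]
  simp [evalAt, linearPart]

theorem D_evalAt_eq_linearCombination_linearPart [Differential F] [DifferentialAlgebra F E]
    {f : DiffPoly Unit F} (hf : f.totalDegree ≤ 1) :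
    KaehlerDifferential.D F E (evalAt (fun _ => u) f) = Finsupp.linearCombination E
      (fun j => (lieDerivative F E)^[j] (KaehlerDifferential.D F E u)) (linearPart E f) := by
  conv_lhs => rw [eq_C_add_sum_of_totalDegree_le_one hf]
  simp [evalAt, linearPart, iterate_lieDerivative_D]

theorem linearCombination_fractionForm (hp : p.totalDegree ≤ 1) (hq : q.totalDegree ≤ 1)
    (hα : α * evalAt (fun _ => u) q = evalAt (fun _ => u) p) :
    Finsupp.linearCombination E (fun j => (⇑Differential.deriv)^[j] u) (fractionForm p q α) =
      α * algebraMap F E (q.coeff 0) - algebraMap F E (p.coeff 0) := by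
  rw [evalAt_eq_add_linearCombination_linearPart hp,
    evalAt_eq_add_linearCombination_linearPart hq] at hα
  rw [fractionForm, map_sub, map_smul, smul_eq_mul]
  linear_combination -hα

theorem linearCombination_fractionForm_D [Differential F] [DifferentialAlgebra F E]
    (hp : p.totalDegree ≤ 1) (hq : q.totalDegree ≤ 1)
    (hα : α * evalAt (fun _ => u) q = evalAt (fun _ => u) p) :
    Finsupp.linearCombination E (fun j => (lieDerivative F E)^[j] (KaehlerDifferential.D F E u))
        (fractionForm p q α) =
      evalAt (fun _ => u) q • KaehlerDifferential.D F E α := by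
  have hD := congrArg (KaehlerDifferential.D F E) hα
  rw [Derivation.leibniz] at hD
  rw [fractionForm, map_sub, map_smul, ← D_evalAt_eq_linearCombination_linearPart hp,
    ← D_evalAt_eq_linearCombination_linearPart hq, ← hD, add_sub_cancel_left]

end LinearFractions

end DiffPoly

section RationalPoints

open DiffPoly MvPolynomial

variable {F E : Type*} [Field F] [Field E] [Differential E] [Algebra F E]
  {p q : DiffPoly Unit F} {u : E}

theorem IsDiffTranscendental.evalAt_injective (hu : IsDiffTranscendental F u) :
    Function.Injective (evalAt (F := F) fun _ : Unit => u) :=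
  AlgebraicIndependent.comp hu (Prod.snd : Unit × ℕ → ℕ) fun _ _ h => Prod.ext rfl h

theorem IsDiffTranscendental.evalAt_ne_zero (hu : IsDiffTranscendental F u) (hq : q ≠ 0) :
    evalAt (fun _ => u) q ≠ 0 :=
  (map_ne_zero_iff _ hu.evalAt_injective).mpr hq

theorem evalAt_div_mem_range_iff (hu : IsDiffTranscendental F u) (hq : q ≠ 0)
    (hrel : IsRelPrime p q) :
    evalAt (fun _ => u) p / evalAt (fun _ => u) q ∈ Set.range (algebraMap F E) ↔
      p.vars ∪ q.vars = ∅ := by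
  rw [Finset.union_eq_empty, vars_eq_empty_iff_eq_C, vars_eq_empty_iff_eq_C]
  constructor
  · rintro ⟨c, hc⟩
    rw [eq_div_iff (hu.evalAt_ne_zero hq)] at hc
    have hp : p = C c * q := by
      apply hu.evalAt_injective
      rw [map_mul, ← hc, ← algebraMap_eq, AlgHom.commutes]
    have hunit : IsUnit q := hrel ⟨C c, by rw [hp, mul_comm]⟩ dvd_rfl
    obtain ⟨a, -, rfl⟩ := isUnit_iff_eq_C_of_isReduced.mp hunit
    rw [hp, ← C_mul, coeff_C, coeff_C, if_pos rfl, if_pos rfl]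
    exact ⟨rfl, rfl⟩
  · rintro ⟨hp, hq⟩
    refine ⟨p.coeff 0 / q.coeff 0, ?_⟩
    rw [hp, hq, ← algebraMap_eq, AlgHom.commutes, AlgHom.commutes, map_div₀]
    simp

theorem ratOrd_eq_bot_iff : ratOrd p q = ⊥ ↔ p.vars ∪ q.vars = ∅ := by
  rw [ratOrd, max_eq_bot, ord_eq_bot_iff, ord_eq_bot_iff, Finset.union_eq_empty,
    Finset.eq_empty_iff_forall_notMem, Finset.eq_empty_iff_forall_notMem]
  simp only [Prod.forall, Unique.forall_iff]

theorem le_ratOrd {j : ℕ} (hj : ((), j) ∈ p.vars ∪ q.vars) : (j : WithBot ℕ) ≤ ratOrd p q :=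
  (Finset.mem_union.mp hj).elim (fun h => (le_ord h).trans (le_max_left _ _))
    fun h => (le_ord h).trans (le_max_right _ _)

theorem mem_vars_of_ratOrd_eq {n : ℕ} (hn : ratOrd p q = n) : ((), n) ∈ p.vars ∪ q.vars := by
  rw [ratOrd] at hn
  rcases max_choice (ord () p) (ord () q) with h | h
  · exact Finset.mem_union_left _ (ord_eq_coe_iff.mp (h.symm.trans hn)).1
  · exact Finset.mem_union_right _ (ord_eq_coe_iff.mp (h.symm.trans hn)).1

theorem hasOrder_D_div [Differential F] [DifferentialAlgebra F E] (hu : IsDiffTranscendental F u)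
    (hp : p.totalDegree ≤ 1) (hq : q.totalDegree ≤ 1) (hq_ne : q ≠ 0) (hrel : IsRelPrime p q)
    {n : ℕ} (hn : ratOrd p q = n) :
    HasOrder E (lieDerivative F E) (KaehlerDifferential.D F E u)
      (KaehlerDifferential.D F E (evalAt (fun _ => u) p / evalAt (fun _ => u) q)) n := by
  have hmem := mem_vars_of_ratOrd_eq hn
  refine hasOrder_of_linearCombination_eq_smul (hu.evalAt_ne_zero hq_ne)
    (linearCombination_fractionForm_D hp hq (div_mul_cancel₀ _ (hu.evalAt_ne_zero hq_ne)))
    (fractionForm_apply_ne_zero hp hq ?_ hmem)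
    fun j hj => fractionForm_apply_eq_zero hp hq fun hjmem => ?_
  · exact fun h => Finset.ne_empty_of_mem hmem ((evalAt_div_mem_range_iff hu hq_ne hrel).mp h)
  · exact hj.not_ge (WithBot.coe_le_coe.mp ((le_ratOrd hjmem).trans_eq hn))

theorem IsDiffTranscendental.linearIndependent_iterate_lieDerivative [CharZero F] [Differential F]
    [DifferentialAlgebra F E] (hu : IsDiffTranscendental F u) :
    LinearIndependent E fun k => (lieDerivative F E)^[k] (KaehlerDifferential.D F E u) := by
  simp only [iterate_lieDerivative_D]
  exact linearIndependent_D_of_algebraicIndependent hu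

end RationalPoints

section DiffAdjoin

variable {F E ι : Type*} [Field F] [Field E] [Differential E] [Algebra F E]

theorem iterate_deriv_mem_diffAdjoin {S : Set E} {a : E} (ha : a ∈ S) (k : ℕ) :
    (⇑Differential.deriv)^[k] a ∈ diffAdjoin F S :=
  IntermediateField.subset_adjoin F _ ⟨a, ha, k, rfl⟩

theorem evalAt_mem_diffAdjoin_singleton (u : E) (f : DiffPoly Unit F) :
    DiffPoly.evalAt (fun _ => u) f ∈ diffAdjoin F {u} := by
  have hrange : (DiffPoly.evalAt (F := F) fun _ : Unit => u).range ≤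
      (diffAdjoin F {u}).toSubalgebra := by
    rw [DiffPoly.evalAt, ← Algebra.adjoin_range_eq_range_aeval, Algebra.adjoin_le_iff]
    rintro _ ⟨w, rfl⟩
    exact iterate_deriv_mem_diffAdjoin (Set.mem_singleton u) w.2
  exact hrange ⟨f, rfl⟩

variable [Differential F] [DifferentialAlgebra F E]

theorem deriv_mem_diffAdjoin {S : Set E} {x : E} (hx : x ∈ diffAdjoin F S) :
    Differential.deriv x ∈ diffAdjoin F S := by
  induction hx using IntermediateField.adjoin_induction with
  | mem x hx =>
    obtain ⟨a, ha, k, rfl⟩ := hx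
    rw [← Function.iterate_succ_apply' (⇑Differential.deriv)]
    exact iterate_deriv_mem_diffAdjoin ha (k + 1)
  | algebraMap a => rw [deriv_algebraMap]; exact IntermediateField.algebraMap_mem _ _
  | add x y _ _ hx hy => rw [map_add]; exact add_mem hx hy
  | inv x hx hx' =>
    rw [Derivation.leibniz_inv, smul_eq_mul]
    exact mul_mem (neg_mem (pow_mem (inv_mem hx) 2)) hx'
  | mul x y hx hy hx' hy' =>
    rw [Derivation.leibniz]
    exact add_mem (mul_mem hx hy') (mul_mem hy hx')

theorem diffAdjoin_le {S T : Set E} (h : S ⊆ diffAdjoin F T) :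
    diffAdjoin F S ≤ diffAdjoin F T := by
  rw [diffAdjoin, IntermediateField.adjoin_le_iff]
  rintro _ ⟨a, ha, k, rfl⟩
  exact Set.MapsTo.iterate (fun _ => deriv_mem_diffAdjoin) k (h ha)

theorem isProperParam_iff_mem {P Q : Fin 2 → DiffPoly Unit F} {u : E} :
    IsProperParam P Q u ↔ u ∈ diffAdjoin F (Set.range (ratPoint P Q u)) := by
  have hle : diffAdjoin F (Set.range (ratPoint P Q u)) ≤ diffAdjoin F {u} := by
    refine diffAdjoin_le ?_
    rintro _ ⟨i, rfl⟩
    exact div_mem (evalAt_mem_diffAdjoin_singleton u _) (evalAt_mem_diffAdjoin_singleton u _)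
  refine ⟨fun h => ?_, fun h => hle.antisymm (diffAdjoin_le (Set.singleton_subset_iff.mpr h))⟩
  rw [h]
  exact iterate_deriv_mem_diffAdjoin (Set.mem_singleton u) 0

theorem exists_D_mem_orbitSpan_sup_of_mem_diffAdjoin {η : ι → E} {i j : ι}
    (hij : ∀ l, l = i ∨ l = j) {z : E} (hz : z ∈ diffAdjoin F (Set.range η)) :
    ∃ s t, KaehlerDifferential.D F E z ∈
      orbitSpan E (lieDerivative F E) (KaehlerDifferential.D F E (η i)) s ⊔
        orbitSpan E (lieDerivative F E) (KaehlerDifferential.D F E (η j)) t := by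
  let W : ℕ → Submodule E Ω[E⁄F] := fun n =>
    orbitSpan E (lieDerivative F E) (KaehlerDifferential.D F E (η i)) n ⊔
      orbitSpan E (lieDerivative F E) (KaehlerDifferential.D F E (η j)) n
  have hW : Monotone W := fun _ _ h => sup_le_sup (orbitSpan_mono h) (orbitSpan_mono h)
  have hspan : Submodule.span E (KaehlerDifferential.D F E ''
      {b | ∃ a ∈ Set.range η, ∃ k : ℕ, b = (⇑Differential.deriv)^[k] a}) ≤ ⨆ n, W n := by
    rw [Submodule.span_le]
    rintro _ ⟨_, ⟨_, ⟨l, rfl⟩, k, rfl⟩, rfl⟩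
    refine Submodule.mem_iSup_of_mem (k + 1) ?_
    rw [← iterate_lieDerivative_D]
    rcases hij l with rfl | rfl
    · exact Submodule.mem_sup_left (iterate_mem_orbitSpan_of_lt k.lt_succ_self)
    · exact Submodule.mem_sup_right (iterate_mem_orbitSpan_of_lt k.lt_succ_self)
  obtain ⟨n, hn⟩ :=
    (Submodule.mem_iSup_of_directed W hW.directed_le).mp (hspan (D_mem_span_of_mem_adjoin hz))
  exact ⟨n, n, hn⟩

end DiffAdjoin

section RationalForms

open DiffPoly

variable {F E : Type*} [Field F] [Field E] [Differential E] [Algebra F E]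

/-- The linear differential forms with coefficients in `L` whose value at `u` lies in `L`. They
serve to descend an `E`-linear relation between differentials to a relation over `L`. -/
noncomputable def rationalForms (L : IntermediateField F E) (u : E) : Submodule L (ℕ →₀ E) where
  carrier := {ζ | (∀ j, ζ j ∈ L) ∧
    Finsupp.linearCombination E (fun j => (⇑Differential.deriv)^[j] u) ζ ∈ L}
  zero_mem' := ⟨fun _ => zero_mem L, by rw [map_zero]; exact zero_mem L⟩
  add_mem' hζ hξ := ⟨fun j => add_mem (hζ.1 j) (hξ.1 j), by
    rw [map_add]; exact add_mem hζ.2 hξ.2⟩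
  smul_mem' c ζ hζ := ⟨fun j => mul_mem c.2 (hζ.1 j), by
    rw [← IsScalarTower.algebraMap_smul E, map_smul]; exact mul_mem c.2 hζ.2⟩

variable {L : IntermediateField F E} {u : E}

theorem formDeriv_mem_rationalForms (hL : ∀ x ∈ L, Differential.deriv x ∈ L) {ζ : ℕ →₀ E}
    (hζ : ζ ∈ rationalForms L u) : formDeriv E ζ ∈ rationalForms L u := by
  refine ⟨fun j => ?_, ?_⟩
  · cases j with
    | zero => rw [formDeriv_zero]; exact hL _ (hζ.1 0)
    | succ j => rw [formDeriv_succ]; exact add_mem (hL _ (hζ.1 _)) (hζ.1 j)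
  · exact ((isConnection_deriv E).linearCombination_formDeriv u ζ).symm ▸ hL _ hζ.2

theorem fractionForm_mem_rationalForms {p q : DiffPoly Unit F} {α : E} (hp : p.totalDegree ≤ 1)
    (hq : q.totalDegree ≤ 1) (hα : α * evalAt (fun _ => u) q = evalAt (fun _ => u) p)
    (hαL : α ∈ L) : fractionForm p q α ∈ rationalForms L u := by
  refine ⟨fun j => ?_, ?_⟩
  · rw [fractionForm_apply hp hq]
    exact sub_mem (L.algebraMap_mem _) (mul_mem hαL (L.algebraMap_mem _))
  · rw [linearCombination_fractionForm hp hq hα]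
    exact sub_mem (mul_mem hαL (L.algebraMap_mem _)) (L.algebraMap_mem _)

theorem mem_of_single_mem_span_rationalForms
    (h : Finsupp.single 0 1 ∈ Submodule.span E (rationalForms L u : Set (ℕ →₀ E))) : u ∈ L := by
  have hsingle : ∀ j, (Finsupp.single 0 1 : ℕ →₀ E) j ∈ Set.range (algebraMap L E) := fun j => by
    rw [Finsupp.single_apply]
    split_ifs
    exacts [⟨1, map_one _⟩, ⟨0, map_zero _⟩]
  have hmem := mem_span_of_mem_span_extension (fun s hs j => ⟨⟨s j, hs.1 j⟩, rfl⟩) hsingle h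
  rw [Submodule.span_eq] at hmem
  simpa using hmem.2

variable [Differential F] [DifferentialAlgebra F E]

variable (L u) in
/-- The differentials represented, over `E`, by the `L`-rational linear forms in `u`. -/
noncomputable def rationalDifferentials : Submodule E Ω[E⁄F] :=
  (Submodule.span E (rationalForms L u : Set (ℕ →₀ E))).map (Finsupp.linearCombination E
    fun j => (lieDerivative F E)^[j] (KaehlerDifferential.D F E u))

theorem linearCombination_mem_rationalDifferentials {ζ : ℕ →₀ E} (hζ : ζ ∈ rationalForms L u) :
    Finsupp.linearCombination E
        (fun j => (lieDerivative F E)^[j] (KaehlerDifferential.D F E u)) ζ ∈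
      rationalDifferentials L u :=
  Submodule.mem_map_of_mem (Submodule.subset_span hζ)

theorem lieDerivative_mem_rationalDifferentials (hL : ∀ x ∈ L, Differential.deriv x ∈ L)
    {z : Ω[E⁄F]} (hz : z ∈ rationalDifferentials L u) :
    lieDerivative F E z ∈ rationalDifferentials L u := by
  have hconn := isConnection_lieDerivative F E
  rw [rationalDifferentials, Submodule.map_span] at hz
  refine hconn.map_mem_of_mem_span ?_ ?_ hz
  · rintro _ ⟨ζ, hζ, rfl⟩
    exact linearCombination_mem_rationalDifferentials hζ
  · rintro _ ⟨ζ, hζ, rfl⟩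
    rw [← hconn.linearCombination_formDeriv]
    exact linearCombination_mem_rationalDifferentials (formDeriv_mem_rationalForms hL hζ)

theorem D_div_mem_rationalDifferentials {p q : DiffPoly Unit F} (hp : p.totalDegree ≤ 1)
    (hq : q.totalDegree ≤ 1) (hqu : evalAt (fun _ => u) q ≠ 0)
    (hL : evalAt (fun _ => u) p / evalAt (fun _ => u) q ∈ L) :
    KaehlerDifferential.D F E (evalAt (fun _ => u) p / evalAt (fun _ => u) q) ∈
      rationalDifferentials L u := by
  have hα := div_mul_cancel₀ (evalAt (fun _ => u) p) hqu
  rw [← Submodule.smul_mem_iff _ hqu, ← linearCombination_fractionForm_D hp hq hα]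
  exact linearCombination_mem_rationalDifferentials
    (fractionForm_mem_rationalForms hp hq hα hL)

theorem orbitSpan_le_rationalDifferentials (hL : ∀ x ∈ L, Differential.deriv x ∈ L) {z : Ω[E⁄F]}
    (hz : z ∈ rationalDifferentials L u) (n : ℕ) :
    orbitSpan E (lieDerivative F E) z n ≤ rationalDifferentials L u :=
  orbitSpan_le fun i _ => Set.MapsTo.iterate
    (s := (rationalDifferentials L u : Set Ω[E⁄F]))
    (fun _ => lieDerivative_mem_rationalDifferentials hL) i hz

theorem mem_of_D_mem_rationalDifferentials [CharZero F] (hu : IsDiffTranscendental F u)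
    (h : KaehlerDifferential.D F E u ∈ rationalDifferentials L u) : u ∈ L := by
  obtain ⟨ξ, hξ, hDu⟩ := h
  obtain rfl : ξ = Finsupp.single 0 1 := hu.linearIndependent_iterate_lieDerivative (by
    rw [hDu, Finsupp.linearCombination_single, one_smul, Function.iterate_zero_apply])
  exact mem_of_single_mem_span_rationalForms hξ

theorem isProperParam_iff_exists_D_mem [CharZero F] {P Q : Fin 2 → DiffPoly Unit F}
    (hu : IsDiffTranscendental F u) (hQ : ∀ i, Q i ≠ 0) (hlin : IsLinearRat P Q u) {i j : Fin 2}
    (hij : ∀ l, l = i ∨ l = j) :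
    IsProperParam P Q u ↔ ∃ s t, KaehlerDifferential.D F E u ∈
      orbitSpan E (lieDerivative F E) (KaehlerDifferential.D F E (ratPoint P Q u i)) s ⊔
        orbitSpan E (lieDerivative F E) (KaehlerDifferential.D F E (ratPoint P Q u j)) t := by
  rw [isProperParam_iff_mem]
  refine ⟨exists_D_mem_orbitSpan_sup_of_mem_diffAdjoin hij, ?_⟩
  rintro ⟨s, t, hmem⟩
  have hη (l : Fin 2) : ratPoint P Q u l ∈ diffAdjoin F (Set.range (ratPoint P Q u)) :=
    iterate_deriv_mem_diffAdjoin (Set.mem_range_self l) 0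
  have hspan (l : Fin 2) (n : ℕ) := orbitSpan_le_rationalDifferentials
    (fun _ => deriv_mem_diffAdjoin) (D_div_mem_rationalDifferentials (hlin.degree_num l)
      (hlin.degree_denom l) (hu.evalAt_ne_zero (hQ l)) (hη l)) n
  exact mem_of_D_mem_rationalDifferentials hu (sup_le (hspan i s) (hspan j t) hmem)

end RationalForms

section Cases

open DiffPoly

variable {F : Type*} [Field F] [Differential F] {E : Type*} [Field E] [Differential E]
  [Algebra F E] {A : DiffPoly (Fin 2) F} {r : Fin 2 × ℕ → Fin 2 × ℕ → Prop}
  {v : Fin 2 × ℕ} {P Q : Fin 2 → DiffPoly Unit F} {u : E} {i j : Fin 2}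

theorem ratPoint_mem_range_iff (hu : IsDiffTranscendental F u)
    (hP : IsRatParametrization A v P Q u) :
    ratPoint P Q u i ∈ Set.range (algebraMap F E) ↔ ratOrd (P i) (Q i) = ⊥ :=
  (evalAt_div_mem_range_iff hu (hP.denom_ne_zero i) (hP.reduced i)).trans ratOrd_eq_bot_iff.symm

theorem hasOrder_D_ratPoint [DifferentialAlgebra F E] (hu : IsDiffTranscendental F u)
    (hP : IsRatParametrization A v P Q u) (hlin : IsLinearRat P Q u) {n : ℕ}
    (hn : ratOrd (P i) (Q i) = n) :
    HasOrder E (lieDerivative F E) (KaehlerDifferential.D F E u)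
      (KaehlerDifferential.D F E (ratPoint P Q u i)) n :=
  hasOrder_D_div hu (hlin.degree_num i) (hlin.degree_denom i) (hP.denom_ne_zero i) (hP.reduced i)
    hn

variable [CharZero F] [DifferentialAlgebra F E]

theorem isProperParam_iff_of_ratOrd_eq_bot (hu : IsDiffTranscendental F u) (hA : Irreducible A)
    (hr : IsRanking r) (hv : IsLeader r A v) (hP : IsRatParametrization A v P Q u)
    (hlin : IsLinearRat P Q u) (hij : i ≠ j) (hi : ratOrd (P i) (Q i) = ⊥) {n : ℕ}
    (hn : ratOrd (P j) (Q j) = n) :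
    IsProperParam P Q u ↔ ratOrd (P i) (Q i) = ord j A ∧ ratOrd (P j) (Q j) = ord i A := by
  obtain ⟨c, hc⟩ := (ratPoint_mem_range_iff hu hP).mpr hi
  obtain ⟨hord_i, hord_j⟩ := ord_of_vars_subset_singleton
    (vars_subset_singleton_of_generic hr hv hA hP.generic hc.symm) ⟨v, hv.1⟩
  rw [isProperParam_iff_exists_D_mem hu hP.denom_ne_zero hlin (i := i) (j := j) (by lia), ← hc,
    Derivation.map_algebraMap, hi, hn, hord_i, hord_j j hij.symm, Nat.cast_inj]
  simp only [orbitSpan_of_zero, bot_sup_eq, exists_const, true_and]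
  exact (hasOrder_D_ratPoint hu hP hlin hn).mem_orbitSpan_iff (isConnection_lieDerivative F E)
    hu.linearIndependent_iterate_lieDerivative

theorem ord_ne_bot_of_ratOrd_eq_coe (hu : IsDiffTranscendental F u) (hA : Irreducible A)
    (hr : IsRanking r) (hv : IsLeader r A v) (hP : IsRatParametrization A v P Q u)
    (hlin : IsLinearRat P Q u) (hij : i ≠ j) {n : ℕ} (hn : ratOrd (P i) (Q i) = n) :
    ord j A ≠ ⊥ := by
  intro hj
  have hjv := ord_eq_bot_iff.mp hj
  obtain rfl : v.1 = i := by
    by_contra hvi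
    obtain rfl : v.1 = j := by lia
    exact hjv v.2 hv.1
  have hmem := iterate_lieDerivative_D_mem_of_generic hr hv hA hP.generic (i := j) (a := 0)
    (by lia) (fun k hk => absurd hk (hjv k)) (hv.ord_eq hr)
  rw [orbitSpan_zero, bot_sup_eq] at hmem
  exact (hasOrder_D_ratPoint hu hP hlin hn).iterate_notMem_orbitSpan
    (isConnection_lieDerivative F E) hu.linearIndependent_iterate_lieDerivative _ hmem

theorem isProperParam_iff_of_ratOrd_eq_coe (hu : IsDiffTranscendental F u) (hA : Irreducible A)
    (hr : IsRanking r) (hv : IsLeader r A v) (hP : IsRatParametrization A v P Q u)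
    (hlin : IsLinearRat P Q u) (hij : i ≠ j) {m n : ℕ} (hm : ratOrd (P i) (Q i) = m)
    (hn : ratOrd (P j) (Q j) = n) :
    IsProperParam P Q u ↔ ratOrd (P i) (Q i) = ord j A ∧ ratOrd (P j) (Q j) = ord i A := by
  have hij' : ∀ l, l = i ∨ l = j := by lia
  obtain ⟨b, hb⟩ := WithBot.ne_bot_iff_exists.mp
    (ord_ne_bot_of_ratOrd_eq_coe hu hA hr hv hP hlin hij hm)
  obtain ⟨a, ha⟩ := WithBot.ne_bot_iff_exists.mp
    (ord_ne_bot_of_ratOrd_eq_coe hu hA hr hv hP hlin hij.symm hn)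
  rw [isProperParam_iff_exists_D_mem hu hP.denom_ne_zero hlin hij', hm, hn, ← ha, ← hb]
  simp only [Nat.cast_withBot, WithBot.coe_inj]
  exact (hasOrder_D_ratPoint hu hP hlin hm).mem_sup_iff (isConnection_lieDerivative F E)
    hu.linearIndependent_iterate_lieDerivative (hasOrder_D_ratPoint hu hP hlin hn)
    (hasRelationOrders_of_generic hr hv hA hP.generic hij hij' ha.symm hb.symm)

end Cases

theorem mainTheorem6 {F : Type*} [Field F] [CharZero F] [Differential F]
    {E : Type*} [Field E] [Differential E] [Algebra F E] [DifferentialAlgebra F E]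
    (u : E) (hu : IsDiffTranscendental F u)
    (A : DiffPoly (Fin 2) F) (hA : Irreducible A)
    (r : Fin 2 × ℕ → Fin 2 × ℕ → Prop) (hr : DiffPoly.IsRanking r)
    (v : Fin 2 × ℕ) (hv : DiffPoly.IsLeader r A v)
    (P Q : Fin 2 → DiffPoly Unit F)
    (hP : IsRatParametrization A v P Q u) (hlin : IsLinearRat P Q u) :
    IsProperParam P Q u ↔
      ratOrd (P 0) (Q 0) = DiffPoly.ord 1 A ∧ ratOrd (P 1) (Q 1) = DiffPoly.ord 0 A := by
  cases h0 : ratOrd (P 0) (Q 0) with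
  | bot =>
    cases h1 : ratOrd (P 1) (Q 1) with
    | bot =>
      have hconst (i : Fin 2) := (ratPoint_mem_range_iff (i := i) hu hP).mpr
      exact absurd (Fin.forall_fin_two.mpr ⟨hconst 0 h0, hconst 1 h1⟩) hlin.not_const
    | coe n =>
      rw [← h0, ← h1]
      exact isProperParam_iff_of_ratOrd_eq_bot hu hA hr hv hP hlin zero_ne_one h0 h1
  | coe m =>
    cases h1 : ratOrd (P 1) (Q 1) with
    | bot =>
      rw [← h0, ← h1, and_comm]
      exact isProperParam_iff_of_ratOrd_eq_bot hu hA hr hv hP hlin one_ne_zero h1 h0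
    | coe n =>
      rw [← h0, ← h1]
      exact isProperParam_iff_of_ratOrd_eq_coe hu hA hr hv hP hlin zero_ne_one h0 h1
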